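/- For an integer $k\ge 0$ let $W_k=\{(x_1,\dots,x_k)\in\mathbb{Z}^k : x_1>x_2>\dots>x_k>0\}$ and $\delta=(k,k-1,\dots,1)\in W_k$, and let $e_1,\dots,e_k$ be the standard basis vectors. An oscillating tableau of length $n$ is a sequence $\lambda^0,\lambda^1,\dots,\lambda^n$ of Ferrers diagrams with $\lambda^0=\emptyset$ in which each $\lambda^{s+1}$ is obtained from $\lambda^s$ by adding or by deleting one box; its height is at most $k$ if every $\lambda^s$ has at most $k$ rows. A $W_k$-oscillating walk of length $n$ is a sequence of $n+1$ points of $W_k$ that starts at $\delta$ and in which each step is $e_i$ or $-e_i$ for some $1\le i\le k$. An open matching diagram on the vertices $1,\dots,n$ consists of arcs $(i,j)$ with $i<j$ and of open arcs, which have a left endpoint but no right endpoint, such that every vertex is an endpoint of exactly one arc or open arc. An $r$-nesting is a set of $r$ arcs $(i_1,j_1),\dots,(i_r,j_r)$ with $i_1<\dots<i_r<j_r<\dots<j_1$; a future $r$-nesting (for $r\ge 1$) is an open arc together with an $(r-1)$-nesting all of whose vertices lie to the right of the left endpoint of the open arc (for $r=1$: just an open arc). Theorem. For all nonnegative integers $n,m,k$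 the following sets are in bijection: 1. the oscillating tableaux of length $n$ and height at most $k$ that end in the one-row shape $(m)$, where $(0)=\emptyset$; 2. the $W_k$-oscillating walks of length $n$ that end at $(m+k,k-1,\dots,1)=\delta+me_1$; 3. the open matching diagrams on $n$ vertices with $m$ open arcs that have no $(k+1)$-nesting and no future $(k+1)$-nesting. (If $k=0$ and $m>0$, the endpoint in 2 does not exist, and the claim is only that 1 and 3 are in bijection; if $k=0$ and $m=0$, the endpoint in 2 is $\delta$, the only point of $W_0=\mathbb{Z}^0$.) -/

import Mathlib

/-- `ν` is obtained from `μ` by adding one box. -/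
def YoungDiagram.AddBox (μ ν : YoungDiagram) : Prop :=
  ∃ c : ℕ × ℕ, c ∉ μ.cells ∧ ν.cells = insert c μ.cells

/-- The Ferrers diagram consisting of a single row of length `m` (empty if `m = 0`). -/
def rowShape (m : ℕ) : YoungDiagram where
  cells := {0} ×ˢ Finset.range m
  isLowerSet := by
    rintro ⟨a, b⟩ ⟨c, d⟩ ⟨h₁, h₂⟩ h
    simp only [Finset.coe_product, Finset.coe_singleton, Finset.coe_range, Set.mem_prod,
      Set.mem_singleton_iff, Set.mem_Iio] at h ⊢
    simp only at h₁ h₂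
    omega

/-- Oscillating tableaux of length `n` and height at most `k` that end in a row of length `m`:
sequences of `n + 1` Ferrers diagrams starting from the empty one, in which every step adds or
deletes one box. The height of a diagram is its number of rows, the length of its first column. -/
def oscillatingTableaux (n k m : ℕ) : Set (Fin (n + 1) → YoungDiagram) :=
  {t | t 0 = ⊥ ∧
    (∀ s : Fin n, (t s.castSucc).AddBox (t s.succ) ∨ (t s.succ).AddBox (t s.castSucc)) ∧
    (∀ s, (t s).colLen 0 ≤ k) ∧
    t (Fin.last n) = rowShape m}

/-- `W_k`: integer vectors `(x₁, …, x_k)` with `x₁ > x₂ > ⋯ > x_k > 0`. -/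
def weylChamber (k : ℕ) : Set (Fin k → ℤ) :=
  {x | StrictAnti x ∧ ∀ i, 0 < x i}

/-- The point `δ = (k, k - 1, …, 1)`. -/
def weylDelta (k : ℕ) : Fin k → ℤ := fun i => (k : ℤ) - (i : ℕ)

/-- The point `(m + k, k - 1, …, 1) = δ + m e₁`. It makes sense for `k ≥ 1`, and for `m = 0`,
where it is `δ`. -/
def rowPoint (k m : ℕ) : Fin k → ℤ :=
  fun i => weylDelta k i + if (i : ℕ) = 0 then (m : ℤ) else 0

/-- `W_k`-oscillating walks of length `n` from `δ` to `p`, as sequences of `n + 1` positions: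
they stay in `W_k`, and every step is some `e_j` or `-e_j`. -/
def oscillatingWalks (n k : ℕ) (p : Fin k → ℤ) : Set (Fin (n + 1) → Fin k → ℤ) :=
  {w | w 0 = weylDelta k ∧
    (∀ s, w s ∈ weylChamber k) ∧
    (∀ s : Fin n, ∃ j : Fin k,
      w s.succ = w s.castSucc + Pi.single j 1 ∨ w s.succ = w s.castSucc - Pi.single j 1) ∧
    w (Fin.last n) = p}

/-- Open matching diagrams on `n` vertices in a row: arcs `(i, j)` with `i < j`, and open arcs,
which have a left endpoint only. Every vertex is an endpoint of exactly one arc or open arc. -/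
@[ext]
structure OpenMatching (n : ℕ) where
  arcs : Finset (Fin n × Fin n)
  /-- the left endpoints of the open arcs -/
  openArcs : Finset (Fin n)
  lt_of_mem : ∀ a ∈ arcs, a.1 < a.2
  incidence : ∀ v : Fin n,
    (v ∉ openArcs ∧ ∃! a, a ∈ arcs ∧ (a.1 = v ∨ a.2 = v)) ∨
    (v ∈ openArcs ∧ ∀ a ∈ arcs, a.1 ≠ v ∧ a.2 ≠ v)

namespace OpenMatching

variable {n : ℕ}

/-- The arcs `(i₁, j₁), …, (i_r, j_r)` of `D` satisfy `i₁ < ⋯ < i_r < j_r < ⋯ < j₁`. -/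
def IsNesting (D : OpenMatching n) {r : ℕ} (i j : Fin r → Fin n) : Prop :=
  (∀ a, (i a, j a) ∈ D.arcs) ∧ StrictMono i ∧ StrictAnti j ∧ ∀ a b, i a < j b

/-- `D` contains an `r`-nesting. -/
def HasNesting (D : OpenMatching n) (r : ℕ) : Prop :=
  ∃ i j : Fin r → Fin n, D.IsNesting i j

/-- `D` contains a future `r`-nesting: an open arc to the left of an `(r - 1)`-nesting. -/
def HasFutureNesting (D : OpenMatching n) (r : ℕ) : Prop :=
  ∃ s : ℕ, r = s + 1 ∧ ∃ v ∈ D.openArcs, ∃ i j : Fin s → Fin n,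
    D.IsNesting i j ∧ ∀ a, v < i a

end OpenMatching

/-- Open matching diagrams on `n` vertices with `m` open arcs, with no `(k + 1)`-nesting and no
future `(k + 1)`-nesting. -/
def nonnestingOpenMatchings (n k m : ℕ) : Set (OpenMatching n) :=
  {D | D.openArcs.card = m ∧ ¬ D.HasNesting (k + 1) ∧ ¬ D.HasFutureNesting (k + 1)}

/-! Tableaux and walks: adding δ to the row lengths turns diagrams with at most `k` rows into the
points of `W_k`, and adding or deleting a box into a step `e_j` or `-e_j`.

Tableaux and matchings: both are data of one triangular growth diagram `F i s`, `0 ≤ i ≤ s ≤ n`, of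
column-length functions, in which an arc `(i, s)` is a cross in the cell `(i, s)`. The diagonal `F s
s` is the tableau, `F 0 s` is empty, and `F i n` is a row whose length is the number of open arcs
starting before `i`. Fomin's local rule runs both ways. Away from the diagonal
(`LocalRule.exists_backward`, `LocalRule.backward_unique`) it produces the crosses and the shapes `F
i n`; these grow to `(m)`, so they are rows, and an open arc starts wherever they grow. Towards the
diagonal (`LocalRule.exists_forward`, `LocalRule.forward_unique`) it rebuilds the tableau from arcs
and open arcs. Consecutive diagonal shapes differ by exactly one box, which says that every vertex
lies on exactly one arc or open arc (`IsGrowth.incidence`).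

Height: in the manner of Schensted (`IsGrowth.le_first_col_iff`), the first column of `F i s` is as
long as the longest chain of nested arcs that start before `i` and end at or after `s`, where one
open arc may serve as the outermost. Only one may, because a row has a first column of length at
most one. On the diagonal these chains are exactly the nestings and future nestings. -/

namespace YoungDiagram

/-! ### Young diagrams as column-length and row-length functions -/

theorem colLen_injective : Function.Injective YoungDiagram.colLen := by
  intro μ ν h
  ext ⟨i, j⟩
  rw [mem_cells, mem_cells, mem_iff_lt_colLen, mem_iff_lt_colLen, h]

theorem rowLen_injective : Function.Injective YoungDiagram.rowLen := by
  intro μ ν h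
  ext ⟨i, j⟩
  rw [mem_cells, mem_cells, mem_iff_lt_rowLen, mem_iff_lt_rowLen, h]

theorem addBox_iff_colLen {μ ν : YoungDiagram} :
    μ.AddBox ν ↔ ∃ c, ν.colLen = μ.colLen + Pi.single c 1 := by
  constructor
  · rintro ⟨⟨a, b⟩, hc, hν⟩
    have key : ∀ i j, i < ν.colLen j ↔ (i = a ∧ j = b) ∨ i < μ.colLen j := by
      intro i j
      rw [← mem_iff_lt_colLen, ← mem_iff_lt_colLen, ← mem_cells, hν, Finset.mem_insert,
        Prod.mk.injEq, mem_cells]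
    have ha : ¬ a < μ.colLen b := by rwa [← mem_iff_lt_colLen, ← mem_cells]
    refine ⟨b, funext fun j => ?_⟩
    rw [Pi.add_apply, Pi.single_apply]
    split_ifs with hj
    · subst hj
      have h1 := key a j
      have h2 := key (μ.colLen j) j
      have h3 := key (μ.colLen j + 1) j
      have h4 := key (a + 1) j
      omega
    · have h1 := key (ν.colLen j) j
      have h2 := key (μ.colLen j) j
      omega
  · rintro ⟨c, hc⟩
    refine ⟨(μ.colLen c, c), ?_, ?_⟩
    · rw [mem_cells, mem_iff_lt_colLen]
      exact lt_irrefl _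
    · ext ⟨i, j⟩
      rw [Finset.mem_insert, mem_cells, mem_cells, mem_iff_lt_colLen, mem_iff_lt_colLen, hc,
        Pi.add_apply, Pi.single_apply, Prod.mk.injEq]
      split_ifs with hj
      · subst hj
        omega
      · omega

theorem AddBox.transpose {μ ν : YoungDiagram} (h : μ.AddBox ν) :
    μ.transpose.AddBox ν.transpose := by
  obtain ⟨c, hc, hν⟩ := h
  refine ⟨c.swap, by simpa using hc, ?_⟩
  ext d
  have := congrArg (fun s => d.swap ∈ s) hν
  simp only [Finset.mem_insert, mem_cells, eq_iff_iff] at this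
  rw [Finset.mem_insert, mem_cells, mem_cells, mem_transpose, mem_transpose, this,
    Prod.swap_eq_iff_eq_swap]

theorem addBox_iff_rowLen {μ ν : YoungDiagram} :
    μ.AddBox ν ↔ ∃ c, ν.rowLen = μ.rowLen + Pi.single c 1 := by
  have h : ∀ μ : YoungDiagram, μ.rowLen = μ.transpose.colLen := fun μ =>
    funext fun i => (μ.colLen_transpose i).symm
  rw [h, h, ← addBox_iff_colLen]
  exact ⟨AddBox.transpose, fun h => by simpa using h.transpose⟩

theorem exists_colLen_eq {p : ℕ → ℕ} (hp : Antitone p) {N : ℕ} (hN : p N = 0) :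
    ∃ μ : YoungDiagram, μ.colLen = p := by
  let μ : YoungDiagram :=
    { cells := (Finset.range (p 0) ×ˢ Finset.range N).filter fun c => c.1 < p c.2
      isLowerSet := by
        rintro ⟨a, b⟩ ⟨c, d⟩ ⟨h₁, h₂⟩ h
        simp only [Finset.coe_filter, Finset.mem_product, Finset.mem_range, Set.mem_ofPred_eq]
          at h h₁ h₂ ⊢
        have := hp h₂
        omega }
  refine ⟨μ, funext fun j => ?_⟩
  have key : ∀ i, i < μ.colLen j ↔ i < p j := by
    intro i
    rw [← mem_iff_lt_colLen, ← mem_cells]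
    simp only [μ, Finset.mem_filter, Finset.mem_product, Finset.mem_range]
    refine ⟨fun h => h.2, fun h => ⟨⟨h.trans_le (hp (Nat.zero_le j)), ?_⟩, h⟩⟩
    by_contra hj
    have := hp (not_lt.mp hj)
    omega
  have h1 := key (μ.colLen j)
  have h2 := key (p j)
  omega

theorem exists_rowLen_eq {p : ℕ → ℕ} (hp : Antitone p) {N : ℕ} (hN : p N = 0) :
    ∃ μ : YoungDiagram, μ.rowLen = p := by
  obtain ⟨μ, hμ⟩ := exists_colLen_eq hp hN
  exact ⟨μ.transpose, by rw [← hμ]; exact funext fun i => μ.rowLen_transpose i⟩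

theorem antitone_colLen (μ : YoungDiagram) : Antitone μ.colLen :=
  fun _ _ h => μ.colLen_anti _ _ h

theorem colLen_bot : (⊥ : YoungDiagram).colLen = 0 := by
  funext j
  by_contra h
  have h0 : (0, j) ∈ (⊥ : YoungDiagram) := mem_iff_lt_colLen.mpr (Nat.pos_of_ne_zero h)
  exact notMem_bot _ h0

theorem rowLen_bot : (⊥ : YoungDiagram).rowLen = 0 := by
  funext i
  by_contra h
  have h0 : (i, 0) ∈ (⊥ : YoungDiagram) := mem_iff_lt_rowLen.mpr (Nat.pos_of_ne_zero h)
  exact notMem_bot _ h0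

theorem rowLen_eq_zero_iff (μ : YoungDiagram) (k : ℕ) : μ.rowLen k = 0 ↔ μ.colLen 0 ≤ k := by
  rw [← not_lt, ← mem_iff_lt_colLen, mem_iff_lt_rowLen]
  omega

end YoungDiagram

/-! ### One-row shapes; tableaux as walks in the Weyl chamber -/

theorem mem_rowShape (m i j : ℕ) : (i, j) ∈ rowShape m ↔ i = 0 ∧ j < m := by
  rw [← YoungDiagram.mem_cells]
  simp [rowShape, eq_comm, and_comm]

/-- The column lengths of a single row of length `m`. -/
def rowCols (m : ℕ) : ℕ → ℕ := fun c => if c < m then 1 else 0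

theorem colLen_rowShape (m : ℕ) : (rowShape m).colLen = rowCols m := by
  funext j
  have key : ∀ i, i < (rowShape m).colLen j ↔ i = 0 ∧ j < m := fun i => by
    rw [← YoungDiagram.mem_iff_lt_colLen, mem_rowShape]
  unfold rowCols
  have h0 := key 0
  have h1 := key 1
  split_ifs with h <;> omega

theorem rowLen_rowShape (m i : ℕ) : (rowShape m).rowLen i = if i = 0 then m else 0 := by
  have key : ∀ j, j < (rowShape m).rowLen i ↔ i = 0 ∧ j < m := fun j => by
    rw [← YoungDiagram.mem_iff_lt_rowLen, mem_rowShape]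
  have h0 := key ((rowShape m).rowLen i)
  have h1 := key m
  split_ifs with h <;> have h2 := key 0 <;> omega

/-- The point of the Weyl chamber attached to a diagram with at most `k` rows: its row lengths,
shifted by `δ`. -/
def weylPoint (k : ℕ) (μ : YoungDiagram) : Fin k → ℤ := fun i => μ.rowLen i + weylDelta k i

theorem weylPoint_mem (k : ℕ) (μ : YoungDiagram) : weylPoint k μ ∈ weylChamber k := by
  refine ⟨fun i j hij => ?_, fun i => ?_⟩
  · have := μ.rowLen_anti i j hij.le
    have hij' : (i : ℕ) < j := hij
    simp only [weylPoint, weylDelta]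
    omega
  · have := i.2
    simp only [weylPoint, weylDelta]
    omega

theorem weylPoint_injOn {k : ℕ} {μ ν : YoungDiagram} (hμ : μ.colLen 0 ≤ k) (hν : ν.colLen 0 ≤ k)
    (h : weylPoint k μ = weylPoint k ν) : μ = ν := by
  apply YoungDiagram.rowLen_injective
  funext i
  by_cases hi : i < k
  · have := congrFun h ⟨i, hi⟩
    simp only [weylPoint] at this
    omega
  · rw [(μ.rowLen_eq_zero_iff i).mpr (by omega), (ν.rowLen_eq_zero_iff i).mpr (by omega)]

theorem exists_weylPoint_eq {k : ℕ} {x : Fin k → ℤ} (hx : x ∈ weylChamber k) :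
    ∃ μ : YoungDiagram, μ.colLen 0 ≤ k ∧ weylPoint k μ = x := by
  let p : ℕ → ℕ := fun i => if h : i < k then (x ⟨i, h⟩ - weylDelta k ⟨i, h⟩).toNat else 0
  -- Strictly decreasing positive integers dominate δ. The induction goes from the last coordinate
  -- leftwards, `d` being the number of coordinates to the right of `i`; it makes the `toNat` in `p`
  -- lossless.
  have hge : ∀ d i (h : i < k), k = i + 1 + d → weylDelta k ⟨i, h⟩ ≤ x ⟨i, h⟩ := by
    intro d
    induction d with
    | zero =>
      intro i h hk
      have := hx.2 ⟨i, h⟩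
      simp only [weylDelta]
      omega
    | succ d ih =>
      intro i h hk
      have h1 := ih (i + 1) (by omega) (by omega)
      have h2 : x ⟨i + 1, by omega⟩ < x ⟨i, h⟩ := hx.1 (Fin.mk_lt_mk.mpr (Nat.lt_succ_self i))
      simp only [weylDelta] at h1 ⊢
      push_cast at h1
      omega
  have hp : Antitone p := by
    apply antitone_nat_of_succ_le
    intro i
    simp only [p]
    split_ifs with h1 h2 h2
    · have h3 : x ⟨i + 1, h1⟩ < x ⟨i, h2⟩ := hx.1 (Fin.mk_lt_mk.mpr (Nat.lt_succ_self i))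
      simp only [weylDelta]
      push_cast
      omega
    all_goals omega
  have hk : p k = 0 := by simp [p]
  obtain ⟨μ, hμ⟩ := YoungDiagram.exists_rowLen_eq hp hk
  refine ⟨μ, ?_, funext fun i => ?_⟩
  · rw [← YoungDiagram.rowLen_eq_zero_iff, hμ, hk]
  · have := hge (k - (i + 1)) i i.2 (by omega)
    simp only [weylPoint, hμ, p, i.2, dif_pos, Fin.eta] at this ⊢
    omega

theorem addBox_iff_weylPoint {k : ℕ} {μ ν : YoungDiagram} (hμ : μ.colLen 0 ≤ k)
    (hν : ν.colLen 0 ≤ k) :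
    μ.AddBox ν ↔ ∃ j : Fin k, weylPoint k ν = weylPoint k μ + Pi.single j 1 := by
  rw [YoungDiagram.addBox_iff_rowLen]
  constructor
  · rintro ⟨c, hc⟩
    have hck : c < k := by
      by_contra h
      have h1 := congrFun hc c
      rw [(ν.rowLen_eq_zero_iff c).mpr (by omega), Pi.add_apply, Pi.single_eq_same] at h1
      omega
    refine ⟨⟨c, hck⟩, funext fun i => ?_⟩
    have h1 := congrFun hc i
    simp only [Pi.add_apply, Pi.single_apply, weylPoint, Fin.ext_iff] at h1 ⊢
    split_ifs at h1 ⊢ <;> omega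
  · rintro ⟨j, hj⟩
    refine ⟨j, funext fun i => ?_⟩
    rw [Pi.add_apply, Pi.single_apply]
    by_cases hi : i < k
    · have h1 := congrFun hj ⟨i, hi⟩
      simp only [Pi.add_apply, Pi.single_apply, weylPoint, Fin.ext_iff] at h1
      split_ifs at h1 ⊢ <;> omega
    · rw [(μ.rowLen_eq_zero_iff i).mpr (by omega), (ν.rowLen_eq_zero_iff i).mpr (by omega),
        if_neg (by have := j.2; omega), add_zero]

theorem weylPoint_bot (k : ℕ) : weylPoint k ⊥ = weylDelta k := by
  funext i
  simp [weylPoint, YoungDiagram.rowLen_bot]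

theorem weylPoint_rowShape (k m : ℕ) : weylPoint k (rowShape m) = rowPoint k m := by
  funext i
  simp only [weylPoint, rowPoint, rowLen_rowShape]
  split_ifs <;> simp [add_comm]

theorem nonempty_tableaux_equiv_walks (n : ℕ) {k m : ℕ} (hkm : 1 ≤ k ∨ m = 0) :
    Nonempty (oscillatingTableaux n k m ≃ oscillatingWalks n k (rowPoint k m)) := by
  -- The only place where `hkm` matters: a nonempty row needs `k ≥ 1`.
  have hrow : (rowShape m).colLen 0 ≤ k := by
    rw [colLen_rowShape, rowCols]
    split_ifs <;> omega
  have hbot : (⊥ : YoungDiagram).colLen 0 ≤ k := by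
    rw [YoungDiagram.colLen_bot]
    exact Nat.zero_le k
  have hstep : ∀ {μ ν : YoungDiagram}, μ.colLen 0 ≤ k → ν.colLen 0 ≤ k →
      (μ.AddBox ν ∨ ν.AddBox μ ↔ ∃ j : Fin k, weylPoint k ν = weylPoint k μ + Pi.single j 1 ∨
        weylPoint k ν = weylPoint k μ - Pi.single j 1) := by
    intro μ ν hμ hν
    rw [addBox_iff_weylPoint hμ hν, addBox_iff_weylPoint hν hμ, exists_or]
    simp only [eq_sub_iff_add_eq, eq_comm]
  let f : oscillatingTableaux n k m → oscillatingWalks n k (rowPoint k m) := fun t =>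
    ⟨fun s => weylPoint k (t.1 s), (congrArg _ t.2.1).trans (weylPoint_bot k), fun s => weylPoint_mem _ _,
      fun s => (hstep (t.2.2.2.1 _) (t.2.2.2.1 _)).mp (t.2.2.1 s),
      (congrArg _ t.2.2.2.2).trans (weylPoint_rowShape k m)⟩
  refine ⟨Equiv.ofBijective f ⟨fun t u h => ?_, fun w => ?_⟩⟩
  · refine Subtype.ext (funext fun s => ?_)
    exact weylPoint_injOn (t.2.2.2.1 s) (u.2.2.2.1 s) (congrFun (congrArg Subtype.val h) s)
  · obtain ⟨w, h0, hw, hs, hl⟩ := w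
    choose t htk ht using fun s => exists_weylPoint_eq (hw s)
    refine ⟨⟨t, ?_, fun s => ?_, htk, ?_⟩, Subtype.ext (funext ht)⟩
    · exact weylPoint_injOn (htk 0) hbot (by rw [ht, h0, weylPoint_bot])
    · rw [hstep (htk _) (htk _), ht, ht]
      exact hs s
    · exact weylPoint_injOn (htk _) hrow (by rw [ht, hl, weylPoint_rowShape])

/-! ### Fomin's local rule -/

/-- `q` equals `p` or is obtained from it by adding a box in some column. -/
def WeakAdd (p q : ℕ → ℕ) : Prop := q = p ∨ ∃ c, q = p + Pi.single c 1

/-- Fomin's local rule for a cell of a growth diagram with corners `ρ ≤ μ, ν ≤ lam`, in terms of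
column lengths: a cell containing a cross adds a box to the first column, and two equal boxes
bump to the next column. -/
def LocalRule (ρ μ ν lam : ℕ → ℕ) (X : Prop) : Prop :=
  (X ∧ μ = ρ ∧ ν = ρ ∧ lam = ρ + Pi.single 0 1) ∨
  (¬ X ∧ ((μ = ρ ∧ lam = ν) ∨ (ν = ρ ∧ lam = μ) ∨
    (∃ a b, a ≠ b ∧ μ = ρ + Pi.single a 1 ∧ ν = ρ + Pi.single b 1 ∧
      lam = ρ + Pi.single a 1 + Pi.single b 1) ∨
    ∃ c, μ = ρ + Pi.single c 1 ∧ ν = μ ∧ lam = μ + Pi.single (c + 1) 1))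

theorem add_single_ne (p : ℕ → ℕ) (c : ℕ) : p + Pi.single c 1 ≠ p := by
  intro h
  have := congrFun h c
  simp at this

theorem add_single_inj {p : ℕ → ℕ} {a b : ℕ} :
    p + Pi.single a 1 = p + Pi.single b 1 ↔ a = b := by
  refine ⟨fun h => ?_, fun h => by rw [h]⟩
  have := congrFun (add_left_cancel h) a
  rw [Pi.single_eq_same, Pi.single_apply] at this
  by_contra hab
  simp [hab] at this

theorem WeakAdd.refl (p : ℕ → ℕ) : WeakAdd p p := Or.inl rfl

theorem WeakAdd.add_single (p : ℕ → ℕ) (c : ℕ) : WeakAdd p (p + Pi.single c 1) :=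
  Or.inr ⟨c, rfl⟩

theorem WeakAdd.le {p q : ℕ → ℕ} (h : WeakAdd p q) : p ≤ q := by
  rcases h with rfl | ⟨c, rfl⟩
  · exact le_rfl
  · exact le_self_add

namespace LocalRule

variable {ρ ρ' μ ν lam lam' : ℕ → ℕ} {X X' : Prop}

theorem exists_forward (hμ : WeakAdd ρ μ) (hν : WeakAdd ρ ν) (hX : X → μ = ρ ∧ ν = ρ) :
    ∃ lam, LocalRule ρ μ ν lam X := by
  by_cases h : X
  · exact ⟨_, Or.inl ⟨h, (hX h).1, (hX h).2, rfl⟩⟩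
  · rcases hμ with rfl | ⟨a, rfl⟩
    · exact ⟨_, Or.inr ⟨h, Or.inl ⟨rfl, rfl⟩⟩⟩
    rcases hν with rfl | ⟨b, rfl⟩
    · exact ⟨_, Or.inr ⟨h, Or.inr (Or.inl ⟨rfl, rfl⟩)⟩⟩
    by_cases hab : a = b
    · subst hab
      exact ⟨_, Or.inr ⟨h, Or.inr (Or.inr (Or.inr ⟨a, rfl, rfl, rfl⟩))⟩⟩
    · exact ⟨_, Or.inr ⟨h, Or.inr (Or.inr (Or.inl ⟨a, b, hab, rfl, rfl, rfl⟩))⟩⟩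

theorem forward_unique (h : LocalRule ρ μ ν lam X) (h' : LocalRule ρ μ ν lam' X) :
    lam = lam' := by
  rcases h with ⟨hX, -, -, rfl⟩ | ⟨hX, h⟩
  · rcases h' with ⟨-, -, -, rfl⟩ | ⟨hX', -⟩
    · rfl
    · exact absurd hX hX'
  rcases h' with ⟨hX', -⟩ | ⟨-, h'⟩
  · exact absurd hX' hX
  rcases h with ⟨rfl, rfl⟩ | ⟨rfl, rfl⟩ | ⟨a, b, hab, rfl, rfl, rfl⟩ | ⟨c, rfl, rfl, rfl⟩
  · rcases h' with ⟨-, h⟩ | ⟨h, h'⟩ | ⟨a', b', -, h, -⟩ | ⟨c', h, -⟩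
    · exact h.symm
    · exact h.trans h'.symm
    · exact absurd h.symm (add_single_ne _ _)
    · exact absurd h.symm (add_single_ne _ _)
  · rcases h' with ⟨h, h'⟩ | ⟨-, h⟩ | ⟨a', b', -, -, h, -⟩ | ⟨c', h, h', -⟩
    · exact h.trans h'.symm
    · exact h.symm
    · exact absurd h.symm (add_single_ne _ _)
    · exact absurd (h'.trans h).symm (add_single_ne _ _)
  · rcases h' with ⟨h, -⟩ | ⟨h, -⟩ | ⟨a', b', -, h, h', h''⟩ | ⟨c', -, h, -⟩
    · exact absurd h (add_single_ne _ _)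
    · exact absurd h (add_single_ne _ _)
    · rw [h'', ← add_single_inj.mp h, ← add_single_inj.mp h']
    · exact absurd (add_single_inj.mp h).symm hab
  · rcases h' with ⟨h, -⟩ | ⟨h, -⟩ | ⟨a', b', hab, h, h', -⟩ | ⟨c', h, -, h'⟩
    · exact absurd h (add_single_ne _ _)
    · exact absurd h (add_single_ne _ _)
    · exact absurd (add_single_inj.mp (h.symm.trans h')) hab
    · rw [h', ← add_single_inj.mp h]

/-- If both edges into `lam` add the same box, its column tells its origin: in the first column it
comes from a cross, in column `c + 1` it was bumped from column `c`. -/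
theorem exists_backward (hμ : WeakAdd μ lam) (hν : WeakAdd ν lam) (aμ : Antitone μ)
    (alam : Antitone lam) : ∃ ρ X, LocalRule ρ μ ν lam X := by
  rcases hμ with rfl | ⟨a, rfl⟩
  · exact ⟨ν, False, Or.inr ⟨not_false, Or.inr (Or.inl ⟨rfl, rfl⟩)⟩⟩
  rcases hν with rfl | ⟨b, hb⟩
  · exact ⟨μ, False, Or.inr ⟨not_false, Or.inl ⟨rfl, rfl⟩⟩⟩
  by_cases hab : a = b
  · subst hab
    obtain rfl := add_right_cancel hb
    cases a with
    | zero => exact ⟨μ, True, Or.inl ⟨trivial, rfl, rfl, rfl⟩⟩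
    | succ c =>
      -- Before column `c + 1` received its box, column `c` was strictly longer, so the truncated
      -- subtraction in column `c` is a true one.
      have h1 := alam (Nat.le_succ c)
      simp only [Pi.add_apply, Pi.single_apply, Nat.succ_eq_add_one] at h1
      have h2 : μ = (μ - Pi.single c 1) + Pi.single c 1 := by
        funext i
        simp only [Pi.add_apply, Pi.sub_apply, Pi.single_apply]
        split_ifs with hi
        · subst hi
          simp at h1
          omega
        · rfl
      exact ⟨μ - Pi.single c 1, False, Or.inr ⟨not_false,
        Or.inr (Or.inr (Or.inr ⟨c, h2, rfl, rfl⟩))⟩⟩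
  · have h2 : μ = (μ - Pi.single b 1) + Pi.single b 1 := by
      funext i
      have := congrFun hb i
      simp only [Pi.add_apply, Pi.sub_apply, Pi.single_apply] at this ⊢
      split_ifs at this ⊢ <;> omega
    have h3 : ν = (μ - Pi.single b 1) + Pi.single a 1 := by
      funext i
      have := congrFun hb i
      simp only [Pi.add_apply, Pi.sub_apply, Pi.single_apply] at this ⊢
      split_ifs at this ⊢ <;> omega
    refine ⟨μ - Pi.single b 1, False, Or.inr ⟨not_false,
      Or.inr (Or.inr (Or.inl ⟨b, a, Ne.symm hab, h2, h3, ?_⟩))⟩⟩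
    rw [← h2]

/-- The corners `μ`, `ν`, `lam` reveal the case of the rule: cases overlap only when all four shapes
agree, and a cross differs from a bump because a bump never lands in column `0`. -/
theorem backward_unique (h : LocalRule ρ μ ν lam X) (h' : LocalRule ρ' μ ν lam X') :
    ρ = ρ' ∧ (X ↔ X') := by
  have comm : ∀ (p : ℕ → ℕ) a b, p + Pi.single a 1 + Pi.single b 1 =
      p + Pi.single b 1 + Pi.single a 1 := fun p a b => add_right_comm _ _ _
  rcases h with ⟨hX, rfl, rfl, rfl⟩ | ⟨hX, h⟩
  · rcases h' with ⟨hX', h1, -⟩ | ⟨hX', h'⟩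
    · exact ⟨h1, iff_of_true hX hX'⟩
    · exfalso
      rcases h' with ⟨-, h⟩ | ⟨-, h⟩ | ⟨a, b, hab, h1, h2, -⟩ | ⟨c, -, -, h⟩
      · exact add_single_ne _ _ h
      · exact add_single_ne _ _ h
      · exact hab (add_single_inj.mp (h1.symm.trans h2))
      · exact absurd (add_single_inj.mp h) (Nat.succ_ne_zero c).symm
  · rcases h' with ⟨hX', rfl, rfl, rfl⟩ | ⟨hX', h'⟩
    · exfalso
      rcases h with ⟨-, h⟩ | ⟨-, h⟩ | ⟨a, b, hab, h1, h2, -⟩ | ⟨c, -, -, h⟩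
      · exact add_single_ne _ _ h
      · exact add_single_ne _ _ h
      · exact hab (add_single_inj.mp (h1.symm.trans h2))
      · exact absurd (add_single_inj.mp h) (Nat.succ_ne_zero c).symm
    · refine ⟨?_, iff_of_false hX hX'⟩
      rcases h with ⟨rfl, rfl⟩ | ⟨rfl, rfl⟩ | ⟨a, b, hab, rfl, rfl, rfl⟩ | ⟨c, rfl, rfl, rfl⟩
      · rcases h' with ⟨h1, -⟩ | ⟨h1, h2⟩ | ⟨a', b', hab', h1, h2, h3⟩ | ⟨c', h1, h2, h3⟩
        · exact h1
        · exact h2.symm.trans h1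
        · rw [comm, ← h2] at h3
          exact absurd h3.symm (add_single_ne _ _)
        · rw [← h2] at h3
          exact absurd h3.symm (add_single_ne _ _)
      · rcases h' with ⟨h1, h2⟩ | ⟨h1, -⟩ | ⟨a', b', hab', h1, h2, h3⟩ | ⟨c', h1, h2, h3⟩
        · exact h2.symm.trans h1
        · exact h1
        · rw [← h1] at h3
          exact absurd h3.symm (add_single_ne _ _)
        · exact absurd h3.symm (add_single_ne _ _)
      · rcases h' with ⟨-, h⟩ | ⟨-, h⟩ | ⟨a', b', hab', h1, h2, h3⟩ | ⟨c', -, h, -⟩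
        · rw [comm] at h
          exact absurd h (add_single_ne _ _)
        · exact absurd h (add_single_ne _ _)
        · rw [← h1] at h3
          obtain rfl := add_single_inj.mp h3
          exact add_right_cancel h2
        · exact absurd (add_single_inj.mp h).symm hab
      · rcases h' with ⟨-, h⟩ | ⟨-, h⟩ | ⟨a', b', hab', h1, h2, -⟩ | ⟨c', h1, -, h3⟩
        · exact absurd h (add_single_ne _ _)
        · exact absurd h (add_single_ne _ _)
        · exact absurd (add_single_inj.mp (h1.symm.trans h2)) hab'
        · obtain rfl := Nat.succ_injective (add_single_inj.mp h3)
          exact add_right_cancel h1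

/-- Every case of the rule displays this edge, except one in which it coincides with the opposite
edge. The same holds for the next three edges; the bottom ones serve the backward construction, the
top ones the forward one. -/
theorem weakAdd_left_bot (h : LocalRule ρ μ ν lam X) (hν : WeakAdd ν lam) : WeakAdd ρ μ := by
  rcases h with ⟨-, rfl, rfl, rfl⟩ | ⟨-, ⟨rfl, rfl⟩ | ⟨rfl, rfl⟩ | ⟨a, b, -, rfl, rfl, rfl⟩ |
    ⟨c, rfl, rfl, rfl⟩⟩
  · exact WeakAdd.refl _
  · exact WeakAdd.refl _
  · exact hν
  · exact WeakAdd.add_single _ _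
  · exact WeakAdd.add_single _ _

theorem weakAdd_right_bot (h : LocalRule ρ μ ν lam X) (hμ : WeakAdd μ lam) : WeakAdd ρ ν := by
  rcases h with ⟨-, rfl, rfl, rfl⟩ | ⟨-, ⟨rfl, rfl⟩ | ⟨rfl, rfl⟩ | ⟨a, b, -, rfl, rfl, rfl⟩ |
    ⟨c, rfl, rfl, rfl⟩⟩
  · exact WeakAdd.refl _
  · exact hμ
  · exact WeakAdd.refl _
  · exact WeakAdd.add_single _ _
  · exact WeakAdd.add_single _ _

theorem weakAdd_left_top (h : LocalRule ρ μ ν lam X) (hν : WeakAdd ρ ν) : WeakAdd μ lam := by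
  rcases h with ⟨-, rfl, rfl, rfl⟩ | ⟨-, ⟨rfl, rfl⟩ | ⟨rfl, rfl⟩ | ⟨a, b, -, rfl, rfl, rfl⟩ |
    ⟨c, rfl, rfl, rfl⟩⟩
  · exact WeakAdd.add_single _ _
  · exact hν
  · exact WeakAdd.refl _
  · exact WeakAdd.add_single _ _
  · exact WeakAdd.add_single _ _

theorem weakAdd_right_top (h : LocalRule ρ μ ν lam X) (hμ : WeakAdd ρ μ) : WeakAdd ν lam := by
  rcases h with ⟨-, rfl, rfl, rfl⟩ | ⟨-, ⟨rfl, rfl⟩ | ⟨rfl, rfl⟩ | ⟨a, b, -, rfl, rfl, rfl⟩ |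
    ⟨c, rfl, rfl, rfl⟩⟩
  · exact WeakAdd.add_single _ _
  · exact WeakAdd.refl _
  · exact hμ
  · rw [add_right_comm]
    exact WeakAdd.add_single _ _
  · exact WeakAdd.add_single _ _

/-- Opposite edges are trivial together, unless a cross turns a trivial edge into a nontrivial one.
This is what makes edges count crosses. -/
theorem eq_left_top_iff (h : LocalRule ρ μ ν lam X) : μ = lam ↔ ρ = ν ∧ ¬ X := by
  rcases h with ⟨hX, rfl, rfl, rfl⟩ | ⟨hX, ⟨rfl, rfl⟩ | ⟨rfl, rfl⟩ | ⟨a, b, -, rfl, rfl, rfl⟩ |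
    ⟨c, rfl, rfl, rfl⟩⟩
  · simp [hX]
  · simp [hX]
  · simp [hX]
  · simp [hX]
  · simp [hX]

theorem eq_right_top_iff (h : LocalRule ρ μ ν lam X) : ν = lam ↔ ρ = μ ∧ ¬ X := by
  rcases h with ⟨hX, rfl, rfl, rfl⟩ | ⟨hX, ⟨rfl, rfl⟩ | ⟨rfl, rfl⟩ | ⟨a, b, -, rfl, rfl, rfl⟩ |
    ⟨c, rfl, rfl, rfl⟩⟩
  · simp [hX]
  · simp [hX]
  · simp [hX]
  · rw [add_right_comm]
    simp [hX]
  · simp [hX]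

theorem eq_of_cross (h : LocalRule ρ μ ν lam X) (hX : X) : ρ = μ ∧ ρ = ν := by
  rcases h with ⟨-, rfl, rfl, -⟩ | ⟨h, -⟩
  · exact ⟨rfl, rfl⟩
  · exact absurd hX h

/-- A bumped box has room in column `c + 1`, since `ρ (c + 1) ≤ ρ c < μ c`. -/
theorem antitone_top (h : LocalRule ρ μ ν lam X) (aρ : Antitone ρ) (aμ : Antitone μ)
    (aν : Antitone ν) : Antitone lam := by
  apply antitone_nat_of_succ_le
  intro i
  have h1 : ρ (i + 1) ≤ ρ i := aρ (Nat.le_succ i)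
  have h2 : μ (i + 1) ≤ μ i := aμ (Nat.le_succ i)
  have h3 : ν (i + 1) ≤ ν i := aν (Nat.le_succ i)
  rcases h with ⟨hX, rfl, rfl, rfl⟩ | ⟨hX, ⟨rfl, rfl⟩ | ⟨rfl, rfl⟩ | ⟨a, b, hab, rfl, rfl, rfl⟩ |
    ⟨c, rfl, rfl, rfl⟩⟩
  · rw [Pi.add_apply, Pi.single_eq_of_ne (Nat.succ_ne_zero i), add_zero]
    exact h1.trans le_self_add
  · exact h3
  · exact h2
  · simp only [Pi.add_apply, Pi.single_apply] at h1 h2 h3 ⊢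
    split_ifs at h1 h2 h3 ⊢ <;> omega
  · simp only [Pi.add_apply, Pi.single_apply] at h1 h2 ⊢
    split_ifs at h1 h2 ⊢ <;> omega

theorem antitone_bot (h : LocalRule ρ μ ν lam X) (aμ : Antitone μ)
    (aν : Antitone ν) (alam : Antitone lam) : Antitone ρ := by
  apply antitone_nat_of_succ_le
  intro i
  have h1 : lam (i + 1) ≤ lam i := alam (Nat.le_succ i)
  have h2 : μ (i + 1) ≤ μ i := aμ (Nat.le_succ i)
  have h3 : ν (i + 1) ≤ ν i := aν (Nat.le_succ i)
  rcases h with ⟨hX, rfl, rfl, rfl⟩ | ⟨hX, ⟨rfl, rfl⟩ | ⟨rfl, rfl⟩ | ⟨a, b, hab, rfl, rfl, rfl⟩ |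
    ⟨c, rfl, rfl, rfl⟩⟩
  · exact h2
  · exact h2
  · exact h3
  · simp only [Pi.add_apply, Pi.single_apply] at h1 h2 h3 ⊢
    split_ifs at h1 h2 h3 ⊢ <;> omega
  · simp only [Pi.add_apply, Pi.single_apply] at h1 h2 ⊢
    split_ifs at h1 h2 ⊢ <;> omega

/-- The first column grows like the length of a longest increasing sequence of crosses. -/
theorem le_first_col_iff (h : LocalRule ρ μ ν lam X) (hμ : WeakAdd ρ μ) (hν : WeakAdd ρ ν)
    (r : ℕ) : r + 1 ≤ lam 0 ↔ r + 1 ≤ μ 0 ∨ r + 1 ≤ ν 0 ∨ X ∧ r ≤ ρ 0 := by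
  have h1 : ρ 0 ≤ μ 0 := hμ.le 0
  have h2 : ρ 0 ≤ ν 0 := hν.le 0
  rcases h with ⟨hX, rfl, rfl, rfl⟩ | ⟨hX, h⟩
  · simp only [Pi.add_apply, Pi.single_eq_same, hX, true_and]
    omega
  -- Without a cross no new box enters the first column: bumped boxes land in columns `c + 1`.
  have : lam 0 = max (μ 0) (ν 0) := by
    rcases h with ⟨rfl, rfl⟩ | ⟨rfl, rfl⟩ | ⟨a, b, hab, rfl, rfl, rfl⟩ | ⟨c, rfl, rfl, rfl⟩
    · omega
    · omega
    · simp only [Pi.add_apply, Pi.single_apply]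
      split_ifs <;> omega
    · simp [Pi.single_apply]
  simp only [hX, false_and, or_false]
  omega

end LocalRule

/-! ### Triangular growth diagrams, determined by the diagonal or by the crosses -/

/-- A triangular growth diagram: shapes `F i s` for `0 ≤ i ≤ s ≤ n`, empty for `i = 0`, obeying
the local rule in the cells `i < s < n`, whose consecutive diagonal shapes differ by one box. -/
structure IsGrowth (n : ℕ) (F : ℕ → ℕ → ℕ → ℕ) (X : ℕ → ℕ → Prop) : Prop where
  zero : ∀ s ≤ n, F 0 s = 0
  antitone : ∀ i s, i ≤ s → s ≤ n → Antitone (F i s)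
  left : ∀ i s, i < s → s ≤ n → WeakAdd (F i s) (F (i + 1) s)
  right : ∀ i s, i ≤ s → s < n → WeakAdd (F i (s + 1)) (F i s)
  rule : ∀ i s, i < s → s < n →
    LocalRule (F i (s + 1)) (F i s) (F (i + 1) (s + 1)) (F (i + 1) s) (X i s)
  diag : ∀ s < n,
    (F s (s + 1) = F s s ∧ ∃ c, F (s + 1) (s + 1) = F s s + Pi.single c 1) ∨
    (F s (s + 1) = F (s + 1) (s + 1) ∧ ∃ c, F s s = F (s + 1) (s + 1) + Pi.single c 1)

section Diagonal

open Classical in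
/-- The lower corner of a cell, given the other three corners. -/
noncomputable def backwardShape (μ ν lam : ℕ → ℕ) : ℕ → ℕ :=
  if h : ∃ ρ X, LocalRule ρ μ ν lam X then h.choose else 0

/-- The shapes at distance `d` from the diagonal, given the diagonal. -/
noncomputable def diagonalGrowth (τ : ℕ → ℕ → ℕ) : ℕ → ℕ → ℕ → ℕ
  | 0, i => τ i
  | 1, i => τ i ⊓ τ (i + 1)
  | d + 2, i => backwardShape (diagonalGrowth τ (d + 1) i) (diagonalGrowth τ (d + 1) (i + 1))
      (diagonalGrowth τ d (i + 1))

theorem exists_localRule_backwardShape {μ ν lam : ℕ → ℕ} (hμ : WeakAdd μ lam)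
    (hν : WeakAdd ν lam) (aμ : Antitone μ) (alam : Antitone lam) :
    ∃ X, LocalRule (backwardShape μ ν lam) μ ν lam X := by
  have h := LocalRule.exists_backward hμ hν aμ alam
  rw [backwardShape, dif_pos h]
  exact h.choose_spec

variable {n : ℕ} {τ : ℕ → ℕ → ℕ}

/-- Two consecutive distances are treated together, because the backward rule needs two corners at
distance `d + 1` and one at distance `d`. -/
theorem diagonalGrowth_spec (ha : ∀ s, Antitone (τ s))
    (hs : ∀ s < n, (∃ c, τ (s + 1) = τ s + Pi.single c 1) ∨ ∃ c, τ s = τ (s + 1) + Pi.single c 1)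
    (d : ℕ) : (∀ i, i + d ≤ n → Antitone (diagonalGrowth τ d i)) ∧
      ∀ i, i + (d + 1) ≤ n → Antitone (diagonalGrowth τ (d + 1) i) ∧
        WeakAdd (diagonalGrowth τ (d + 1) i) (diagonalGrowth τ d i) ∧
        WeakAdd (diagonalGrowth τ (d + 1) i) (diagonalGrowth τ d (i + 1)) := by
  induction d with
  | zero =>
    refine ⟨fun i _ => ha i, fun i hi => ?_⟩
    have h0 : diagonalGrowth τ (0 + 1) i = τ i ⊓ τ (i + 1) := rfl
    rw [h0]
    refine ⟨(ha i).inf (ha (i + 1)), ?_⟩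
    change WeakAdd _ (τ i) ∧ WeakAdd _ (τ (i + 1))
    rcases hs i (by omega) with ⟨c, hc⟩ | ⟨c, hc⟩
    · rw [hc, inf_of_le_left le_self_add]
      exact ⟨WeakAdd.refl _, WeakAdd.add_single _ _⟩
    · rw [hc, inf_of_le_right le_self_add]
      exact ⟨WeakAdd.add_single _ _, WeakAdd.refl _⟩
  | succ d ih =>
    refine ⟨fun i hi => (ih.2 i hi).1, fun i hi => ?_⟩
    have h1 := ih.2 i (by omega)
    have h2 := ih.2 (i + 1) (by omega)
    obtain ⟨X, hX⟩ := exists_localRule_backwardShape h1.2.2 h2.2.1 h1.1 (ih.1 (i + 1) (by omega))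
    exact ⟨hX.antitone_bot h1.1 h2.1 (ih.1 (i + 1) (by omega)), hX.weakAdd_left_bot h2.2.1,
      hX.weakAdd_right_bot h1.2.2⟩

theorem exists_isGrowth_of_diagonal (h0 : τ 0 = 0) (ha : ∀ s, Antitone (τ s))
    (hs : ∀ s < n, (∃ c, τ (s + 1) = τ s + Pi.single c 1) ∨
      ∃ c, τ s = τ (s + 1) + Pi.single c 1) :
    ∃ F X, IsGrowth n F X ∧ ∀ s, F s s = τ s := by
  have spec := diagonalGrowth_spec ha hs
  have hX : ∀ i s, ∃ X, i < s → s < n →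
      LocalRule (diagonalGrowth τ (s + 1 - i) i) (diagonalGrowth τ (s - i) i)
        (diagonalGrowth τ (s + 1 - (i + 1)) (i + 1)) (diagonalGrowth τ (s - (i + 1)) (i + 1)) X := by
    intro i s
    by_cases h : i < s ∧ s < n
    · obtain ⟨d, rfl⟩ := Nat.exists_eq_add_of_lt h.1
      have h1 := (spec d).2 i (by omega)
      have h2 := (spec d).2 (i + 1) (by omega)
      obtain ⟨X, hX⟩ := exists_localRule_backwardShape h1.2.2 h2.2.1 h1.1
        ((spec d).1 (i + 1) (by omega))
      refine ⟨X, fun _ _ => ?_⟩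
      have e1 : i + d + 1 + 1 - i = d + 2 := by omega
      have e2 : i + d + 1 - i = d + 1 := by omega
      have e3 : i + d + 1 + 1 - (i + 1) = d + 1 := by omega
      have e4 : i + d + 1 - (i + 1) = d := by omega
      rw [e1, e2, e3, e4]
      exact hX
    -- Outside the cells of the triangle the value of `X` is arbitrary.
    · exact ⟨True, fun h1 h2 => absurd ⟨h1, h2⟩ h⟩
  choose X hX using hX
  refine ⟨fun i s => diagonalGrowth τ (s - i) i, X, ?_, fun s => by simp [diagonalGrowth]⟩
  refine ⟨?_, ?_, ?_, ?_, hX, ?_⟩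
  -- Shapes shrink as `s` grows, starting from `τ 0 = 0`.
  · intro s hs
    induction s with
    | zero => exact h0
    | succ s ih =>
      have := ((spec s).2 0 (by omega)).2.1.le
      have ih := ih (by omega)
      simp only [Nat.sub_zero] at ih ⊢
      rw [ih] at this
      exact le_antisymm this zero_le
  · intro i s his hsn
    exact (spec (s - i)).1 i (by omega)
  · intro i s his hsn
    obtain ⟨d, rfl⟩ := Nat.exists_eq_add_of_lt his
    have h := ((spec d).2 i (by omega)).2.2
    have e2 : i + d + 1 - i = d + 1 := by omega
    have e4 : i + d + 1 - (i + 1) = d := by omega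
    simp only [e2, e4]
    exact h
  · intro i s his hsn
    obtain ⟨d, rfl⟩ := Nat.exists_eq_add_of_le his
    have h := ((spec d).2 i (by omega)).2.1
    have e2 : i + d + 1 - i = d + 1 := by omega
    have e4 : i + d - i = d := by omega
    simp only [e2, e4]
    exact h
  · intro s hsn
    have e : s + 1 - s = 1 := by omega
    simp only [e, Nat.sub_self, diagonalGrowth]
    rcases hs s hsn with ⟨c, hc⟩ | ⟨c, hc⟩
    · exact Or.inl ⟨by rw [hc, inf_of_le_left le_self_add], c, hc⟩
    · exact Or.inr ⟨by rw [hc, inf_of_le_right le_self_add], c, hc⟩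

end Diagonal

namespace IsGrowth

variable {n : ℕ} {F F' : ℕ → ℕ → ℕ → ℕ} {X X' : ℕ → ℕ → Prop}

theorem eq_of_diagonal (h : IsGrowth n F X) (h' : IsGrowth n F' X')
    (hd : ∀ s ≤ n, F s s = F' s s) (d : ℕ) :
    (∀ i, i + d ≤ n → F i (i + d) = F' i (i + d)) ∧
      ∀ i, i + (d + 1) ≤ n → F i (i + (d + 1)) = F' i (i + (d + 1)) := by
  induction d with
  | zero =>
    refine ⟨hd, fun i hi => ?_⟩
    have e1 := hd i (by omega)
    have e2 := hd (i + 1) (by omega)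
    -- The diagonal step adds or deletes a box in both diagrams alike; in the mixed cases two added
    -- boxes would have to cancel.
    rcases h.diag i (by omega) with ⟨h1, c, hc⟩ | ⟨h1, c, hc⟩ <;>
    rcases h'.diag i (by omega) with ⟨h1', c', hc'⟩ | ⟨h1', c', hc'⟩
    · exact h1.trans (e1.trans h1'.symm)
    · rw [← e1, ← e2, hc, add_assoc] at hc'
      have := congrFun hc' c
      simp at this
    · rw [← e1, ← e2, hc, add_assoc] at hc'
      have := congrFun hc' c
      simp at this
    · exact h1.trans (e2.trans h1'.symm)
  | succ d ih =>
    refine ⟨ih.2, fun i hi => ?_⟩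
    have r := h.rule i (i + (d + 1)) (by omega) (by omega)
    have r' := h'.rule i (i + (d + 1)) (by omega) (by omega)
    have e1 := ih.2 i (by omega)
    have e2 := ih.2 (i + 1) (by omega)
    have e3 := ih.1 (i + 1) (by omega)
    have a1 : i + 1 + (d + 1) = i + (d + 1) + 1 := by omega
    have a2 : i + 1 + d = i + (d + 1) := by omega
    rw [a1] at e2
    rw [a2] at e3
    rw [← e1, ← e2, ← e3] at r'
    exact (r.backward_unique r').1

theorem cross_iff_of_diagonal (h : IsGrowth n F X) (h' : IsGrowth n F' X')
    (hd : ∀ s ≤ n, F s s = F' s s) {i s : ℕ} (his : i < s) (hsn : s < n) : X i s ↔ X' i s := by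
  have key : ∀ i s, i ≤ s → s ≤ n → F i s = F' i s := by
    intro i s h1 h2
    obtain ⟨d, rfl⟩ := Nat.exists_eq_add_of_le h1
    exact (eq_of_diagonal h h' hd d).1 i h2
  have r := h.rule i s his hsn
  have r' := h'.rule i s his hsn
  rw [← key i s his.le hsn.le, ← key (i + 1) (s + 1) (by omega) hsn,
    ← key (i + 1) s his hsn.le] at r'
  exact (r.backward_unique r').2

/-- The shapes with `i = 0` or `s = n` agree, and the forward rule propagates this with increasing
`i` and decreasing `s`. -/
theorem eq_of_crosses (h : IsGrowth n F X) (h' : IsGrowth n F' X)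
    (ht : ∀ i ≤ n, F i n = F' i n) {i s : ℕ} (his : i ≤ s) (hsn : s ≤ n) : F i s = F' i s := by
  induction i generalizing s with
  | zero => rw [h.zero s hsn, h'.zero s hsn]
  | succ i ih =>
    induction hsn using Nat.decreasingInduction with
    | self => exact ht _ his
    | of_succ s hsn ihs =>
      have r := h.rule i s his hsn
      have r' := h'.rule i s his hsn
      rw [← ih (by omega) (by omega), ← ih (by omega) (by omega), ← ihs (by omega)] at r'
      exact r.forward_unique r'

end IsGrowth

/-! ### Counting the crosses at a vertex -/

section Counting

open Classical in
/-- The number of crosses `(v, b)` with `s ≤ b < n`. -/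
noncomputable def outCount (X : ℕ → ℕ → Prop) (n v s : ℕ) : ℕ :=
  ((Finset.Ico s n).filter (X v)).card

open Classical in
/-- The number of crosses `(a, v)` with `a < i`. -/
noncomputable def inCount (X : ℕ → ℕ → Prop) (i v : ℕ) : ℕ :=
  ((Finset.range i).filter fun a => X a v).card

open Classical in
/-- The number of `v < i` with `P v`. -/
noncomputable def countBelow (P : ℕ → Prop) (i : ℕ) : ℕ := ((Finset.range i).filter P).card

variable {X : ℕ → ℕ → Prop} {P : ℕ → Prop} {n v s i : ℕ}

theorem outCount_self : outCount X n v n = 0 := by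
  simp [outCount]

theorem outCount_of_cross (hs : s < n) (h : X v s) :
    outCount X n v s = outCount X n v (s + 1) + 1 := by
  rw [outCount, ← Finset.insert_Ico_add_one_left_eq_Ico hs, Finset.filter_insert, if_pos h,
    Finset.card_insert_of_notMem (by simp), outCount]

theorem outCount_of_not_cross (hs : s < n) (h : ¬ X v s) :
    outCount X n v s = outCount X n v (s + 1) := by
  rw [outCount, ← Finset.insert_Ico_add_one_left_eq_Ico hs, Finset.filter_insert, if_neg h,
    outCount]

theorem outCount_anti {t : ℕ} (h : s ≤ t) : outCount X n v t ≤ outCount X n v s := by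
  classical
  exact Finset.card_le_card (Finset.filter_subset_filter _ (Finset.Ico_subset_Ico_left h))

theorem countBelow_zero : countBelow P 0 = 0 := by
  simp [countBelow]

theorem countBelow_succ_of_pos (h : P i) : countBelow P (i + 1) = countBelow P i + 1 := by
  rw [countBelow, Finset.range_add_one, Finset.filter_insert, if_pos h,
    Finset.card_insert_of_notMem (by simp), countBelow]

theorem countBelow_succ_of_neg (h : ¬ P i) : countBelow P (i + 1) = countBelow P i := by
  rw [countBelow, Finset.range_add_one, Finset.filter_insert, if_neg h, countBelow]

theorem countBelow_pos_iff : 0 < countBelow P i ↔ ∃ v < i, P v := by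
  simp [countBelow, Finset.card_pos, Finset.Nonempty]

theorem inCount_zero : inCount X 0 v = 0 := countBelow_zero

theorem inCount_of_cross (h : X i v) : inCount X (i + 1) v = inCount X i v + 1 :=
  countBelow_succ_of_pos h

theorem inCount_of_not_cross (h : ¬ X i v) : inCount X (i + 1) v = inCount X i v :=
  countBelow_succ_of_neg h

theorem inCount_mono {j : ℕ} (h : i ≤ j) : inCount X i v ≤ inCount X j v := by
  classical
  exact Finset.card_le_card (Finset.filter_subset_filter _ (Finset.range_mono h))

end Counting

namespace IsGrowth

variable {n : ℕ} {F : ℕ → ℕ → ℕ → ℕ} {X : ℕ → ℕ → Prop}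

-- As `s` decreases, the edge from `F v s` to `F (v + 1) s` changes status only at a cross, from
-- trivial to nontrivial. The starting value at `s = n` records an open arc.
open Classical in
theorem left_count (h : IsGrowth n F X) {v s : ℕ} (hs : s ≤ n) (hv : v < s) :
    (if F v s = F (v + 1) s then 0 else 1) =
      (if F v n = F (v + 1) n then 0 else 1) + outCount X n v s := by
  induction hs using Nat.decreasingInduction with
  | self => rw [outCount_self, add_zero]
  | of_succ s hsn ih =>
    have r := h.rule v s hv hsn
    have ih := ih (by omega)
    by_cases hX : X v s
    · rw [if_pos (r.eq_of_cross hX).2] at ih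
      rw [outCount_of_cross hsn hX, if_neg fun e => (r.eq_left_top_iff.mp e).2 hX]
      omega
    · rw [outCount_of_not_cross hsn hX, ← ih]
      simp only [r.eq_left_top_iff, hX, not_false_eq_true, and_true]

open Classical in
theorem right_count (h : IsGrowth n F X) {i v : ℕ} (hv : v < n) (hi : i ≤ v) :
    (if F i (v + 1) = F i v then 0 else 1) = inCount X i v := by
  induction i with
  | zero => rw [h.zero v hv.le, h.zero (v + 1) hv, if_pos rfl, inCount_zero]
  | succ i ih =>
    have r := h.rule i v hi hv
    have ih := ih (by omega)
    by_cases hX : X i v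
    · rw [if_pos (r.eq_of_cross hX).1] at ih
      rw [inCount_of_cross hX, if_neg fun e => (r.eq_right_top_iff.mp e).2 hX]
      omega
    · rw [inCount_of_not_cross hX, ← ih]
      simp only [r.eq_right_top_iff, hX, not_false_eq_true, and_true]

-- Of the two edges leaving `F v (v + 1)` towards the diagonal exactly one is nontrivial; the edge
-- counts turn this into the incidence condition at `v`.
open Classical in
theorem incidence (h : IsGrowth n F X) {v : ℕ} (hv : v < n) :
    (if F v n = F (v + 1) n then 0 else 1) + outCount X n v (v + 1) + inCount X v v = 1 := by
  rw [← h.left_count hv (Nat.lt_succ_self v), ← h.right_count hv le_rfl]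
  rcases h.diag v hv with ⟨h1, c, hc⟩ | ⟨h1, c, hc⟩
  · rw [if_neg (by rw [h1, hc]; exact (add_single_ne _ _).symm), if_pos h1]
  · rw [if_pos h1, if_neg (by rw [h1, hc]; exact (add_single_ne _ _).symm)]

end IsGrowth

/-! ### Growth diagrams from crosses and open arcs -/

section Crosses

open Classical in
/-- The upper corner of a cell, given the other three corners and the crossing. -/
noncomputable def forwardShape (ρ μ ν : ℕ → ℕ) (X : Prop) : ℕ → ℕ :=
  if h : ∃ lam, LocalRule ρ μ ν lam X then h.choose else 0

theorem localRule_forwardShape {ρ μ ν : ℕ → ℕ} {X : Prop} (hμ : WeakAdd ρ μ) (hν : WeakAdd ρ ν)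
    (hX : X → μ = ρ ∧ ν = ρ) : LocalRule ρ μ ν (forwardShape ρ μ ν X) X := by
  have h := LocalRule.exists_forward hμ hν hX
  rw [forwardShape, dif_pos h]
  exact h.choose_spec

/-- The shapes with second index `n - t`, given the crosses `X` and the shapes `B` with second
index `n`. -/
noncomputable def crossGrowth (n : ℕ) (X : ℕ → ℕ → Prop) (B : ℕ → ℕ → ℕ) : ℕ → ℕ → ℕ → ℕ
  | 0, _ => 0
  | i + 1, 0 => B (i + 1)
  | i + 1, t + 1 => forwardShape (crossGrowth n X B i t) (crossGrowth n X B i (t + 1))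
      (crossGrowth n X B (i + 1) t) (X i (n - (t + 1)))
termination_by i t => (i, t)

variable {n : ℕ} {X : ℕ → ℕ → Prop} {P : ℕ → Prop}

theorem antitone_rowCols (m : ℕ) : Antitone (rowCols m) := by
  apply antitone_nat_of_succ_le
  intro c
  unfold rowCols
  split_ifs <;> omega

theorem rowCols_zero : rowCols 0 = 0 := rfl

theorem rowCols_succ (m : ℕ) : rowCols (m + 1) = rowCols m + Pi.single m 1 := by
  funext c
  simp only [rowCols, Pi.add_apply, Pi.single_apply]
  split_ifs <;> omega

-- The forward rule needs trivial lower edges in a cell with a cross. So the construction carries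
-- along which edges are trivial, in terms of the counts, and `hinc` supplies the condition.
open Classical in
theorem exists_isGrowth_of_crosses (hX : ∀ i s, X i s → i < s)
    (hinc : ∀ v < n,
      (if P v then 1 else 0) + outCount X n v (v + 1) + inCount X v v = 1) :
    ∃ F, IsGrowth n F X ∧ ∀ i, F i n = rowCols (countBelow P i) := by
  set F : ℕ → ℕ → ℕ → ℕ := fun i s =>
    crossGrowth n X (fun i => rowCols (countBelow P i)) i (n - s) with hF
  have F0 : ∀ s, F 0 s = 0 := fun s => by simp only [hF, crossGrowth]
  have Fn : ∀ i, F i n = rowCols (countBelow P i) := by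
    intro i
    cases i with
    | zero => rw [F0, countBelow_zero, rowCols_zero]
    | succ i => simp only [hF, Nat.sub_self, crossGrowth]
  have Fsucc : ∀ i s, s < n →
      F (i + 1) s = forwardShape (F i (s + 1)) (F i s) (F (i + 1) (s + 1)) (X i s) := by
    intro i s hs
    obtain ⟨t, rfl⟩ := Nat.exists_eq_add_of_lt hs
    have e1 : s + t + 1 - s = t + 1 := by omega
    have e2 : s + t + 1 - (s + 1) = t := by omega
    have e3 : s + t + 1 - (t + 1) = s := by omega
    simp only [hF, e1, e2]
    rw [crossGrowth, e3]
  -- One cell: edge data on the two lower edges yield the rule and edge data on the two upper edges.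
  have cell : ∀ i s, i < n → s < n →
      (WeakAdd (F i (s + 1)) (F (i + 1) (s + 1)) ∧ (F i (s + 1) = F (i + 1) (s + 1) ↔
        (if P i then 1 else 0) + outCount X n i (s + 1) = 0)) →
      (WeakAdd (F i (s + 1)) (F i s) ∧ (F i (s + 1) = F i s ↔ inCount X i s = 0)) →
      LocalRule (F i (s + 1)) (F i s) (F (i + 1) (s + 1)) (F (i + 1) s) (X i s) ∧
      (WeakAdd (F i s) (F (i + 1) s) ∧ (F i s = F (i + 1) s ↔
        (if P i then 1 else 0) + outCount X n i s = 0)) ∧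
      (WeakAdd (F (i + 1) (s + 1)) (F (i + 1) s) ∧
        (F (i + 1) (s + 1) = F (i + 1) s ↔ inCount X (i + 1) s = 0)) := by
    intro i s hi hs hl hr
    have r : LocalRule (F i (s + 1)) (F i s) (F (i + 1) (s + 1)) (F (i + 1) s) (X i s) := by
      rw [Fsucc i s hs]
      -- The cross `(i, s)` uses up the single incidence of both `i` and `s`, so the counts on the
      -- lower edges vanish.
      refine localRule_forwardShape hr.1 hl.1 fun hx => ?_
      have his := hX i s hx
      have h1 := outCount_of_cross hs hx
      have h2 := outCount_anti (X := X) (n := n) (v := i) (Nat.succ_le_of_lt his)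
      have h3 := hinc i hi
      have h4 := inCount_of_cross hx
      have h5 := inCount_mono (X := X) (v := s) (Nat.succ_le_of_lt his)
      have h6 := hinc s hs
      simp only [Nat.succ_eq_add_one] at h2 h5
      exact ⟨(hr.2.mpr (by omega)).symm, (hl.2.mpr (by omega)).symm⟩
    refine ⟨r, ⟨r.weakAdd_left_top hl.1, ?_⟩, r.weakAdd_right_top hr.1, ?_⟩
    · rw [r.eq_left_top_iff, hl.2]
      by_cases hx : X i s
      · rw [outCount_of_cross hs hx]
        simp [hx]
      · rw [outCount_of_not_cross hs hx]
        simp [hx]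
    · rw [r.eq_right_top_iff, hr.2]
      by_cases hx : X i s
      · rw [inCount_of_cross hx]
        simp [hx]
      · rw [inCount_of_not_cross hx]
        simp [hx]
  have step : ∀ i < n, (∀ s < n, WeakAdd (F i (s + 1)) (F i s) ∧
      (F i (s + 1) = F i s ↔ inCount X i s = 0)) → ∀ s ≤ n, WeakAdd (F i s) (F (i + 1) s) ∧
        (F i s = F (i + 1) s ↔ (if P i then 1 else 0) + outCount X n i s = 0) := by
    intro i hi hr s hs
    induction hs using Nat.decreasingInduction with
    | self =>
      rw [Fn, Fn, outCount_self]
      by_cases hP : P i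
      · rw [countBelow_succ_of_pos hP, rowCols_succ]
        exact ⟨WeakAdd.add_single _ _, by simp [hP]⟩
      · rw [countBelow_succ_of_neg hP]
        exact ⟨WeakAdd.refl _, by simp [hP]⟩
    | of_succ s hsn ih => exact (cell i s hi hsn ih (hr s hsn)).2.1
  have right : ∀ i ≤ n, ∀ s < n, WeakAdd (F i (s + 1)) (F i s) ∧
      (F i (s + 1) = F i s ↔ inCount X i s = 0) := by
    intro i hi
    induction i with
    | zero =>
      intro s _
      rw [F0, F0, inCount_zero]
      exact ⟨WeakAdd.refl _, by simp⟩
    | succ i ih =>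
      intro s hs
      have ih := ih (by omega)
      exact (cell i s hi hs (step i hi ih (s + 1) hs) (ih s hs)).2.2
  have left : ∀ i < n, ∀ s ≤ n, WeakAdd (F i s) (F (i + 1) s) ∧
      (F i s = F (i + 1) s ↔ (if P i then 1 else 0) + outCount X n i s = 0) :=
    fun i hi => step i hi (right i hi.le)
  have rule : ∀ i s, i < n → s < n →
      LocalRule (F i (s + 1)) (F i s) (F (i + 1) (s + 1)) (F (i + 1) s) (X i s) :=
    fun i s hi hs => (cell i s hi hs (left i hi (s + 1) hs) (right i hi.le s hs)).1
  have anti : ∀ i ≤ n, ∀ s ≤ n, Antitone (F i s) := by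
    intro i hi
    induction i with
    | zero =>
      intro s _
      rw [F0]
      exact antitone_const
    | succ i ih =>
      have ih := ih (by omega)
      intro s hs
      induction hs using Nat.decreasingInduction with
      | self =>
        rw [Fn]
        exact antitone_rowCols _
      | of_succ s hsn ihs =>
        exact (rule i s hi hsn).antitone_top (ih _ hsn) (ih _ hsn.le) ihs
  refine ⟨F, ⟨fun s _ => F0 s, fun i s h1 h2 => anti i (h1.trans h2) s h2,
    fun i s h1 h2 => (left i (h1.trans_le h2) s h2).1,
    fun i s h1 h2 => (right i (h1.trans h2.le) s h2).1,
    fun i s h1 h2 => rule i s (h1.trans h2) h2, fun s hs => ?_⟩, Fn⟩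
  have hl := left s hs (s + 1) hs
  have hr := right s hs.le s hs
  have hc := hinc s hs
  by_cases h : inCount X s s = 0
  · have e := hr.2.mpr h
    refine Or.inl ⟨e, ?_⟩
    rcases hl.1 with h1 | ⟨c, h1⟩
    · have := hl.2.mp h1.symm
      omega
    · exact ⟨c, by rw [h1, e]⟩
  · have e := hl.2.mpr (by omega)
    refine Or.inr ⟨e, ?_⟩
    rcases hr.1 with h1 | ⟨c, h1⟩
    · exact absurd (hr.2.mp h1.symm) h
    · exact ⟨c, by rw [h1, e]⟩

end Crosses

/-! ### The boundary shapes are rows -/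

section Row

theorem eq_rowCols_of_eq_add_single {p : ℕ → ℕ} (hp : Antitone p) {c m : ℕ}
    (h : rowCols m = p + Pi.single c 1) : p = rowCols c := by
  have key : ∀ j, (if j < m then 1 else 0) = p j + if j = c then 1 else 0 := fun j => by
    have := congrFun h j
    rwa [Pi.add_apply, Pi.single_apply] at this
  have h1 := key c
  have h2 := key (c + 1)
  have h3 := hp (Nat.le_succ c)
  simp only [Nat.succ_eq_add_one, if_true, Nat.succ_ne_self, if_false] at h1 h2 h3
  -- Column `c` of `p` is empty, hence so is column `c + 1`: the deleted box was the last one of the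
  -- row.
  have hm : m = c + 1 := by
    split_ifs at h1 h2 <;> omega
  funext j
  have h4 := key j
  unfold rowCols
  split_ifs at h4 ⊢ <;> omega

theorem eq_succ_of_rowCols {a b c : ℕ} (h : rowCols b = rowCols a + Pi.single c 1) :
    b = a + 1 := by
  have key : ∀ j, (if j < b then 1 else 0) = (if j < a then 1 else 0) + if j = c then 1 else 0 :=
    fun j => by
      have := congrFun h j
      rwa [Pi.add_apply, Pi.single_apply] at this
  have h1 := key c
  have h2 := key a
  have h3 := key (a + 1)
  simp only [if_true] at h1
  split_ifs at h1 h2 h3 <;> omega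

theorem rowCols_injective : Function.Injective rowCols := by
  intro a b h
  have h1 := congrFun h a
  have h2 := congrFun h b
  simp only [rowCols] at h1 h2
  split_ifs at h1 h2 <;> omega

/-- Going down from `F n n`, deleting boxes from a row leaves only rows; going up from the empty
shape, their lengths count the growing steps. -/
theorem IsGrowth.row {n m : ℕ} {F : ℕ → ℕ → ℕ → ℕ} {X : ℕ → ℕ → Prop} (h : IsGrowth n F X)
    (hm : F n n = rowCols m) {i : ℕ} (hi : i ≤ n) :
    F i n = rowCols (countBelow (fun v => F v n ≠ F (v + 1) n) i) := by
  have ex : ∀ i ≤ n, ∃ a, F i n = rowCols a := by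
    intro i hi
    induction hi using Nat.decreasingInduction with
    | self => exact ⟨m, hm⟩
    | of_succ i hi ih =>
      obtain ⟨a, ha⟩ := ih
      rcases h.left i n hi le_rfl with e | ⟨c, e⟩
      · exact ⟨a, e ▸ ha⟩
      · exact ⟨c, eq_rowCols_of_eq_add_single (h.antitone i n hi.le le_rfl) (ha.symm.trans e)⟩
  induction i with
  | zero => rw [h.zero n le_rfl, countBelow_zero, rowCols_zero]
  | succ i ih =>
    have ih := ih (by omega)
    rcases h.left i n hi le_rfl with e | ⟨c, e⟩
    · rw [countBelow_succ_of_neg (by simp [e]), e, ih]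
    · rw [countBelow_succ_of_pos (by rw [e]; exact (add_single_ne _ _).symm)]
      obtain ⟨a, ha⟩ := ex (i + 1) hi
      rw [ih, ha] at e
      rw [ha, eq_succ_of_rowCols e]

end Row

/-! ### Chains of nested crosses and the first column -/

/-- There is a chain of `r` crosses `(a, b)` with `a < i` and `s ≤ b`, each one having a smaller
`a` and a larger `b` than the one before; the last one may be replaced by some `v` with `P v` to
the left of all of them. -/
def NestChain (X : ℕ → ℕ → Prop) (P : ℕ → Prop) : ℕ → ℕ → ℕ → Prop
  | 0, _, _ => True
  | r + 1, i, s => (r = 0 ∧ ∃ v < i, P v) ∨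
      ∃ a b, X a b ∧ a < i ∧ s ≤ b ∧ NestChain X P r a (b + 1)

namespace NestChain

variable {X : ℕ → ℕ → Prop} {P : ℕ → Prop} {r i s : ℕ}

theorem mono {i' s' : ℕ} (h : NestChain X P r i s) (hi : i ≤ i') (hs : s' ≤ s) :
    NestChain X P r i' s' := by
  cases r with
  | zero => trivial
  | succ r =>
    rcases h with ⟨hr, v, hv, hP⟩ | ⟨a, b, hX, ha, hb, h⟩
    · exact Or.inl ⟨hr, v, by omega, hP⟩
    · exact Or.inr ⟨a, b, hX, by omega, by omega, h⟩

/-- The same recursion that `LocalRule.le_first_col_iff` gives for the first column: a chain avoids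
`i`, or avoids `s`, or has `(i, s)` as its innermost cross. -/
theorem succ_iff : NestChain X P (r + 1) (i + 1) s ↔
    NestChain X P (r + 1) i s ∨ NestChain X P (r + 1) (i + 1) (s + 1) ∨
      X i s ∧ NestChain X P r i (s + 1) := by
  constructor
  · rintro (h | ⟨a, b, hX, ha, hb, h⟩)
    · exact Or.inr (Or.inl (Or.inl h))
    · by_cases hai : a < i
      · exact Or.inl (Or.inr ⟨a, b, hX, hai, hb, h⟩)
      by_cases hbs : s < b
      · exact Or.inr (Or.inl (Or.inr ⟨a, b, hX, ha, hbs, h⟩))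
      obtain rfl : a = i := by omega
      obtain rfl : b = s := by omega
      exact Or.inr (Or.inr ⟨hX, h⟩)
  · rintro (h | h | ⟨hX, h⟩)
    · exact h.mono (Nat.le_succ i) le_rfl
    · exact h.mono le_rfl (Nat.le_succ s)
    · exact Or.inr ⟨i, s, hX, Nat.lt_succ_self i, le_rfl, h⟩

end NestChain

/-- Schensted's theorem for triangular growth diagrams. -/
theorem IsGrowth.le_first_col_iff {n : ℕ} {F : ℕ → ℕ → ℕ → ℕ} {X : ℕ → ℕ → Prop} {P : ℕ → Prop}
    (h : IsGrowth n F X) (hX : ∀ a b, X a b → b < n)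
    (ht : ∀ i ≤ n, F i n = rowCols (countBelow P i)) {i s : ℕ} (his : i ≤ s) (hsn : s ≤ n)
    (r : ℕ) : r ≤ F i s 0 ↔ NestChain X P r i s := by
  induction i generalizing s r with
  | zero =>
    rw [h.zero s hsn]
    cases r with
    | zero => exact iff_of_true (Nat.zero_le _) trivial
    | succ r => simp [NestChain]
  | succ i ih =>
    induction hsn using Nat.decreasingInduction generalizing r with
    | self =>
      rw [ht _ his]
      cases r with
      | zero => exact iff_of_true (Nat.zero_le _) trivial
      | succ r =>
        -- At `s = n` no crosses remain, and the first column of a row is `1` or `0` according to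
        -- whether some open arc starts before `i + 1`.
        have h1 := countBelow_pos_iff (P := P) (i := i + 1)
        have h2 : ¬ ∃ a b, X a b ∧ a < i + 1 ∧ n ≤ b ∧ NestChain X P r a (b + 1) := by
          rintro ⟨a, b, hab, -, hb, -⟩
          exact absurd (hX a b hab) (by omega)
        simp only [NestChain, h2, or_false, ← h1, rowCols]
        split_ifs <;> omega
    | of_succ s hsn ihs =>
      cases r with
      | zero => exact iff_of_true (Nat.zero_le _) trivial
      | succ r =>
        rw [(h.rule i s his hsn).le_first_col_iff (h.right i s (by omega) hsn)
          (h.left i (s + 1) (by omega) hsn), NestChain.succ_iff, ih (by omega) hsn.le,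
          ih (by omega) hsn, ihs (by omega)]

/-! ### Open matchings as crosses; nestings as chains -/

namespace OpenMatching

variable {n : ℕ} {D D' : OpenMatching n}

/-- `(i, s)` is an arc. -/
def Cross (D : OpenMatching n) (i s : ℕ) : Prop :=
  ∃ a ∈ D.arcs, (a.1 : ℕ) = i ∧ (a.2 : ℕ) = s

/-- `v` is the left endpoint of an open arc. -/
def IsOpenAt (D : OpenMatching n) (v : ℕ) : Prop := ∃ w ∈ D.openArcs, (w : ℕ) = v

theorem cross_val {a b : Fin n} : D.Cross a b ↔ (a, b) ∈ D.arcs := by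
  constructor
  · rintro ⟨⟨c, d⟩, h, h1, h2⟩
    rwa [← Fin.ext h1, ← Fin.ext h2]
  · exact fun h => ⟨(a, b), h, rfl, rfl⟩

theorem isOpenAt_val {v : Fin n} : D.IsOpenAt v ↔ v ∈ D.openArcs := by
  constructor
  · rintro ⟨w, h, h1⟩
    rwa [← Fin.ext h1]
  · exact fun h => ⟨v, h, rfl⟩

theorem Cross.lt {i s : ℕ} (h : D.Cross i s) : i < s := by
  obtain ⟨a, ha, rfl, rfl⟩ := h
  exact D.lt_of_mem a ha

theorem Cross.lt_right {i s : ℕ} (h : D.Cross i s) : s < n := by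
  obtain ⟨a, ha, rfl, rfl⟩ := h
  exact a.2.2

theorem ext_of_cross (hX : ∀ i s, i < s → s < n → (D.Cross i s ↔ D'.Cross i s))
    (hP : ∀ v < n, D.IsOpenAt v ↔ D'.IsOpenAt v) : D = D' := by
  ext1
  · ext ⟨a, b⟩
    rw [← cross_val, ← cross_val]
    by_cases h : (a : ℕ) < b
    · exact hX a b h b.2
    · exact iff_of_false (fun h' => h h'.lt) (fun h' => h h'.lt)
  · ext v
    rw [← isOpenAt_val, ← isOpenAt_val]
    exact hP v v.2

theorem countBelow_isOpenAt (D : OpenMatching n) : countBelow D.IsOpenAt n = D.openArcs.card := by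
  classical
  rw [countBelow, ← Finset.card_map Fin.valEmbedding]
  congr 1
  ext v
  simp only [Finset.mem_filter, Finset.mem_range, Finset.mem_map, Fin.valEmbedding_apply, IsOpenAt]
  refine ⟨fun h => h.2, fun h => ⟨?_, h⟩⟩
  obtain ⟨w, -, rfl⟩ := h
  exact w.2

open Classical in
theorem incidence_count (D : OpenMatching n) {v : ℕ} (hv : v < n) :
    (if D.IsOpenAt v then 1 else 0) + outCount D.Cross n v (v + 1) + inCount D.Cross v v = 1 := by
  obtain ⟨w, rfl⟩ : ∃ w : Fin n, (w : ℕ) = v := ⟨⟨v, hv⟩, rfl⟩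
  rcases D.incidence w with ⟨hw, ⟨x, y⟩, ⟨hxy, hor⟩, huniq⟩ | ⟨hw, hno⟩
  · rw [if_neg fun h => hw (isOpenAt_val.mp h)]
    have hlt : (x : ℕ) < y := D.lt_of_mem _ hxy
    have hu : ∀ a b, D.Cross a b → a = w ∨ b = w → a = x ∧ b = y := by
      rintro a b ⟨⟨c, d⟩, hcd, rfl, rfl⟩ h
      have := huniq (c, d) ⟨hcd, h.imp Fin.ext Fin.ext⟩
      rw [Prod.mk.injEq] at this
      exact ⟨congrArg _ this.1, congrArg _ this.2⟩
    have hc : D.Cross x y := cross_val.mpr hxy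
    rcases hor with h | h
    · obtain rfl : x = w := h
      have h1 : outCount D.Cross n x (x + 1) = 1 := by
        rw [outCount, Finset.card_eq_one]
        refine ⟨y, ?_⟩
        ext b
        simp only [Finset.mem_filter, Finset.mem_Ico, Finset.mem_singleton]
        constructor
        · exact fun h => (hu _ _ h.2 (Or.inl rfl)).2
        · rintro rfl
          exact ⟨⟨hlt, y.2⟩, hc⟩
      have h2 : inCount D.Cross x x = 0 := by
        rw [inCount, Finset.card_eq_zero, Finset.filter_eq_empty_iff]
        intro a _ h
        have := (hu _ _ h (Or.inr rfl)).2
        omega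
      omega
    · obtain rfl : y = w := h
      have h1 : inCount D.Cross y y = 1 := by
        rw [inCount, Finset.card_eq_one]
        refine ⟨x, ?_⟩
        ext b
        simp only [Finset.mem_filter, Finset.mem_range, Finset.mem_singleton]
        constructor
        · exact fun h => (hu _ _ h.2 (Or.inr rfl)).1
        · rintro rfl
          exact ⟨hlt, hc⟩
      have h2 : outCount D.Cross n y (y + 1) = 0 := by
        rw [outCount, Finset.card_eq_zero, Finset.filter_eq_empty_iff]
        intro a _ h
        have := (hu _ _ h (Or.inl rfl)).1
        omega
      omega
  · have h1 : outCount D.Cross n w (w + 1) = 0 := by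
      rw [outCount, Finset.card_eq_zero, Finset.filter_eq_empty_iff]
      rintro b _ ⟨a, ha, h, -⟩
      exact (hno a ha).1 (Fin.ext h)
    have h2 : inCount D.Cross w w = 0 := by
      rw [inCount, Finset.card_eq_zero, Finset.filter_eq_empty_iff]
      rintro b _ ⟨a, ha, -, h⟩
      exact (hno a ha).2 (Fin.ext h)
    rw [if_pos (isOpenAt_val.mpr hw), h1, h2]

open Classical in
theorem exists_of_incidence_count {X : ℕ → ℕ → Prop} {P : ℕ → Prop}
    (hinc : ∀ v < n,
      (if P v then 1 else 0) + outCount X n v (v + 1) + inCount X v v = 1) :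
    ∃ D : OpenMatching n, (∀ i s, i < s → s < n → (D.Cross i s ↔ X i s)) ∧
      ∀ v < n, D.IsOpenAt v ↔ P v := by
  have hinc' : ∀ v : Fin n,
      (v ∉ Finset.univ.filter (fun v : Fin n => P v) ∧
        ∃! a, a ∈ Finset.univ.filter (fun a : Fin n × Fin n => a.1 < a.2 ∧ X a.1 a.2) ∧
          (a.1 = v ∨ a.2 = v)) ∨
      (v ∈ Finset.univ.filter (fun v : Fin n => P v) ∧
        ∀ a ∈ Finset.univ.filter (fun a : Fin n × Fin n => a.1 < a.2 ∧ X a.1 a.2),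
          a.1 ≠ v ∧ a.2 ≠ v) := by
    intro v
    have hv := hinc v v.2
    simp only [Finset.mem_filter, Finset.mem_univ, true_and]
    have out0 : outCount X n v (v + 1) = 0 → ∀ b : Fin n, v < b → ¬ X v b := by
      intro h b hb
      rw [outCount, Finset.card_eq_zero, Finset.filter_eq_empty_iff] at h
      exact h (Finset.mem_Ico.mpr ⟨hb, b.2⟩)
    have in0 : inCount X v v = 0 → ∀ a : Fin n, a < v → ¬ X a v := by
      intro h a ha
      rw [inCount, Finset.card_eq_zero, Finset.filter_eq_empty_iff] at h
      exact h (Finset.mem_range.mpr ha)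
    by_cases hP : P v
    · rw [if_pos hP] at hv
      refine Or.inr ⟨hP, ?_⟩
      rintro ⟨a, b⟩ ⟨hab, hX⟩
      constructor
      · rintro rfl
        exact out0 (by omega) b hab hX
      · rintro rfl
        exact in0 (by omega) a hab hX
    · rw [if_neg hP] at hv
      refine Or.inl ⟨hP, ?_⟩
      by_cases hin : inCount X v v = 0
      · have hout : outCount X n v (v + 1) = 1 := by omega
        rw [outCount, Finset.card_eq_one] at hout
        obtain ⟨y, hy⟩ := hout
        have hm : ∀ b, ((v : ℕ) + 1 ≤ b ∧ b < n) ∧ X v b ↔ b = y := fun b => by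
          rw [← Finset.mem_singleton, ← hy, Finset.mem_filter, Finset.mem_Ico]
        obtain ⟨⟨h1, h2⟩, h3⟩ := (hm y).mpr rfl
        refine ⟨(v, ⟨y, h2⟩), ⟨⟨h1, h3⟩, Or.inl rfl⟩, ?_⟩
        rintro ⟨a, b⟩ ⟨⟨hab, hX⟩, h | h⟩
        · obtain rfl : a = v := h
          rw [Prod.mk.injEq]
          exact ⟨rfl, Fin.ext ((hm b).mp ⟨⟨hab, b.2⟩, hX⟩)⟩
        · obtain rfl : b = v := h
          exact absurd hX (in0 hin a hab)
      · have hout : inCount X v v = 1 := by omega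
        have hout0 : outCount X n v (v + 1) = 0 := by omega
        rw [inCount, Finset.card_eq_one] at hout
        obtain ⟨y, hy⟩ := hout
        have hm : ∀ b, b < (v : ℕ) ∧ X b v ↔ b = y := fun b => by
          rw [← Finset.mem_singleton, ← hy, Finset.mem_filter, Finset.mem_range]
        obtain ⟨h1, h3⟩ := (hm y).mpr rfl
        refine ⟨(⟨y, h1.trans v.2⟩, v), ⟨⟨h1, h3⟩, Or.inr rfl⟩, ?_⟩
        rintro ⟨a, b⟩ ⟨⟨hab, hX⟩, h | h⟩
        · obtain rfl : a = v := h
          exact absurd hX (out0 hout0 b hab)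
        · obtain rfl : b = v := h
          rw [Prod.mk.injEq]
          exact ⟨Fin.ext ((hm a).mp ⟨hab, hX⟩), rfl⟩
  let D : OpenMatching n :=
    { arcs := Finset.univ.filter fun a : Fin n × Fin n => a.1 < a.2 ∧ X a.1 a.2
      openArcs := Finset.univ.filter fun v : Fin n => P v
      lt_of_mem := fun a ha => (Finset.mem_filter.mp ha).2.1
      incidence := hinc' }
  refine ⟨D, fun i s his hsn => ?_, fun v hv => ?_⟩
  · have h := cross_val (D := D) (a := ⟨i, his.trans hsn⟩) (b := ⟨s, hsn⟩)
    simp only [D, Finset.mem_filter, Finset.mem_univ, true_and, Fin.mk_lt_mk, his] at h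
    exact h
  · have h := isOpenAt_val (D := D) (v := ⟨v, hv⟩)
    simp only [D, Finset.mem_filter, Finset.mem_univ, true_and] at h
    exact h

theorem IsNesting.snoc {r : ℕ} {f g : Fin r → Fin n} (h : D.IsNesting f g) {p q : Fin n}
    (hpq : (p, q) ∈ D.arcs) (hf : ∀ x, f x < p) (hg : ∀ x, q < g x) :
    D.IsNesting (Fin.snoc (α := fun _ => Fin n) f p) (Fin.snoc (α := fun _ => Fin n) g q) := by
  have hlt : p < q := D.lt_of_mem _ hpq
  obtain ⟨h1, h2, h3, h4⟩ := h
  refine ⟨fun a => ?_, fun a b hab => ?_, fun a b hab => ?_, fun a b => ?_⟩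
  · refine Fin.lastCases ?_ (fun a => ?_) a
    · simpa using hpq
    · simpa using h1 a
  · induction b using Fin.lastCases with
    | last =>
      induction a using Fin.lastCases with
      | last => exact absurd hab (lt_irrefl _)
      | cast a => simpa using hf a
    | cast b =>
      induction a using Fin.lastCases with
      | last => exact absurd hab (not_lt.mpr (Fin.le_last _))
      | cast a => simpa using h2 (Fin.castSucc_lt_castSucc_iff.mp hab)
  · induction b using Fin.lastCases with
    | last =>
      induction a using Fin.lastCases with
      | last => exact absurd hab (lt_irrefl _)
      | cast a => simpa using hg a
    | cast b =>
      induction a using Fin.lastCases with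
      | last => exact absurd hab (not_lt.mpr (Fin.le_last _))
      | cast a => simpa using h3 (Fin.castSucc_lt_castSucc_iff.mp hab)
  · induction b using Fin.lastCases with
    | last =>
      induction a using Fin.lastCases with
      | last => simpa using hlt
      | cast a => simpa using (hf a).trans hlt
    | cast b =>
      induction a using Fin.lastCases with
      | last => simpa using hlt.trans (hg b)
      | cast a => simpa using h4 a b

theorem isNesting_of_isEmpty (f g : Fin 0 → Fin n) : D.IsNesting f g :=
  ⟨fun a => a.elim0, fun a => a.elim0, fun a => a.elim0, fun a => a.elim0⟩

theorem IsNesting.castSucc {r : ℕ} {f g : Fin (r + 1) → Fin n} (h : D.IsNesting f g) :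
    D.IsNesting (fun a : Fin r => f a.castSucc) fun a : Fin r => g a.castSucc :=
  ⟨fun _ => h.1 _, fun _ _ hab => h.2.1 (Fin.castSucc_lt_castSucc_iff.mpr hab),
    fun _ _ hab => h.2.2.1 (Fin.castSucc_lt_castSucc_iff.mpr hab), fun _ _ => h.2.2.2 _ _⟩

/-- The chain is unfolded from the innermost arc outwards, so each arc is appended at the last
index. The bounds by `i` and `s` are what places the arcs found so far outside the one appended. -/
theorem exists_nesting_of_nestChain {r i s : ℕ} (h : NestChain D.Cross D.IsOpenAt r i s) :
    (∃ f g : Fin r → Fin n, D.IsNesting f g ∧ ∀ a, (f a : ℕ) < i ∧ s ≤ g a) ∨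
    ∃ q, r = q + 1 ∧ ∃ v ∈ D.openArcs, (v : ℕ) < i ∧ ∃ f g : Fin q → Fin n,
      D.IsNesting f g ∧ (∀ a, v < f a) ∧ ∀ a, (f a : ℕ) < i ∧ s ≤ g a := by
  induction r generalizing i s with
  | zero => exact Or.inl ⟨Fin.elim0, Fin.elim0, isNesting_of_isEmpty _ _, fun a => a.elim0⟩
  | succ r ih =>
    rcases h with ⟨rfl, _, hv, v, hvo, rfl⟩ | ⟨_, _, ⟨⟨p, q⟩, hpq, rfl, rfl⟩, hp, hq, h⟩
    · exact Or.inr ⟨0, rfl, v, hvo, hv, Fin.elim0, Fin.elim0, isNesting_of_isEmpty _ _,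
        fun a => a.elim0, fun a => a.elim0⟩
    · dsimp only at hp hq h
      rcases ih h with ⟨f, g, hfg, hr⟩ | ⟨r, rfl, v, hvo, hv, f, g, hfg, hvf, hr⟩
      · refine Or.inl ⟨_, _, hfg.snoc hpq (fun x => (hr x).1) (fun x => (hr x).2), fun a => ?_⟩
        refine Fin.lastCases ?_ (fun a => ?_) a
        · simpa using ⟨hp, hq⟩
        · have := hr a
          simp only [Fin.snoc_castSucc]
          omega
      · refine Or.inr ⟨r + 1, rfl, v, hvo, by omega, _, _,
          hfg.snoc hpq (fun x => (hr x).1) (fun x => (hr x).2), fun a => ?_, fun a => ?_⟩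
        · refine Fin.lastCases ?_ (fun a => ?_) a
          · simpa using hv
          · simpa using hvf a
        · refine Fin.lastCases ?_ (fun a => ?_) a
          · simpa using ⟨hp, hq⟩
          · have := hr a
            simp only [Fin.snoc_castSucc]
            omega

theorem IsNesting.nestChain {r : ℕ} {f g : Fin r → Fin n} (h : D.IsNesting f g) {i s : ℕ}
    (hi : ∀ a, (f a : ℕ) < i) (hs : ∀ a, s ≤ g a) : NestChain D.Cross D.IsOpenAt r i s := by
  induction r generalizing i s with
  | zero => trivial
  | succ r ih =>
    exact Or.inr ⟨_, _, cross_val.mpr (h.1 (Fin.last r)), hi _, hs _,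
      ih h.castSucc (fun a => h.2.1 (Fin.castSucc_lt_last a))
        fun a => h.2.2.1 (Fin.castSucc_lt_last a)⟩

theorem IsNesting.nestChain_of_open {r : ℕ} {f g : Fin r → Fin n} (h : D.IsNesting f g) {v : Fin n}
    (hv : v ∈ D.openArcs) (hvf : ∀ a, v < f a) {i s : ℕ} (hvi : (v : ℕ) < i)
    (hi : ∀ a, (f a : ℕ) < i) (hs : ∀ a, s ≤ g a) :
    NestChain D.Cross D.IsOpenAt (r + 1) i s := by
  induction r generalizing i s with
  | zero => exact Or.inl ⟨rfl, v, hvi, isOpenAt_val.mpr hv⟩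
  | succ r ih =>
    exact Or.inr ⟨_, _, cross_val.mpr (h.1 (Fin.last r)), hi _, hs _,
      ih h.castSucc (fun a => hvf _) (hvf _) (fun a => h.2.1 (Fin.castSucc_lt_last a))
        fun a => h.2.2.1 (Fin.castSucc_lt_last a)⟩

/-- All arcs of a nesting pass over a common point `s`, which is where the diagonal shape `F s s`
sees them. -/
theorem exists_nestChain_iff (D : OpenMatching n) (r : ℕ) :
    (∃ s ≤ n, NestChain D.Cross D.IsOpenAt (r + 1) s s) ↔
      D.HasNesting (r + 1) ∨ D.HasFutureNesting (r + 1) := by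
  constructor
  · rintro ⟨s, -, h⟩
    rcases exists_nesting_of_nestChain h with ⟨f, g, h, -⟩ | ⟨q, hq, v, hv, -, f, g, h, hvf, -⟩
    · exact Or.inl ⟨f, g, h⟩
    · exact Or.inr ⟨q, hq, v, hv, f, g, h, hvf⟩
  · rintro (⟨f, g, h⟩ | ⟨q, hq, v, hv, f, g, h, hvf⟩)
    -- `s` is one past the innermost left endpoint: every left endpoint is below it, every right
    -- endpoint at or above it.
    · refine ⟨f (Fin.last r) + 1, (f _).2, h.nestChain (fun a => ?_) fun a => h.2.2.2 _ _⟩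
      exact Nat.lt_succ_of_le (h.2.1.monotone (Fin.le_last a))
    · obtain rfl : r = q := by omega
      cases r with
      -- A lone open arc has no innermost arc to fix `s`; `s = n` lies beyond every vertex.
      | zero => exact ⟨n, le_rfl, h.nestChain_of_open hv hvf v.2 (fun a => a.elim0)
          fun a => a.elim0⟩
      | succ r =>
        refine ⟨f (Fin.last r) + 1, (f _).2, h.nestChain_of_open hv hvf
          (Nat.lt_succ_of_lt (hvf (Fin.last r))) (fun a => ?_) fun a => h.2.2.2 _ _⟩
        exact Nat.lt_succ_of_le (h.2.1.monotone (Fin.le_last a))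

end OpenMatching

/-! ### The correspondence between tableaux and matchings -/

/-- The sequence of diagrams `t` is the diagonal of the growth diagram whose crosses are the arcs
of `D` and whose last row records the open arcs of `D`. -/
def Corresponds {n : ℕ} (t : Fin (n + 1) → YoungDiagram) (D : OpenMatching n) : Prop :=
  ∃ F, IsGrowth n F D.Cross ∧ (∀ i ≤ n, F i n = rowCols (countBelow D.IsOpenAt i)) ∧
    ∀ s : Fin (n + 1), (t s).colLen = F s s

theorem countBelow_congr {P Q : ℕ → Prop} {i : ℕ} (h : ∀ v < i, P v ↔ Q v) :
    countBelow P i = countBelow Q i := by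
  classical
  rw [countBelow, countBelow]
  congr 1
  ext v
  simp only [Finset.mem_filter, Finset.mem_range]
  exact and_congr_right (h v)

namespace Corresponds

variable {n : ℕ} {t u : Fin (n + 1) → YoungDiagram} {D E : OpenMatching n}

theorem exists_matching {m : ℕ} (h0 : t 0 = ⊥)
    (hs : ∀ s : Fin n, (t s.castSucc).AddBox (t s.succ) ∨ (t s.succ).AddBox (t s.castSucc))
    (hm : t (Fin.last n) = rowShape m) : ∃ D, Corresponds t D := by
  classical
  -- The tableau is continued constantly beyond `n`, so that `τ` is total.
  let τ : ℕ → ℕ → ℕ := fun s => (t ⟨min s n, by omega⟩).colLen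
  have hτ : ∀ s : Fin (n + 1), τ s = (t s).colLen := fun s => by
    simp only [τ, min_eq_left (Nat.le_of_lt_succ s.2)]
  obtain ⟨F, X, hF, hd⟩ := exists_isGrowth_of_diagonal (n := n) (τ := τ)
    (by rw [show τ 0 = _ from hτ 0, h0, YoungDiagram.colLen_bot])
    (fun s => YoungDiagram.antitone_colLen _) (by
      intro s hsn
      have h1 : τ s = _ := hτ (Fin.castSucc ⟨s, hsn⟩)
      have h2 : τ (s + 1) = _ := hτ (Fin.succ ⟨s, hsn⟩)
      rw [h1, h2, ← YoungDiagram.addBox_iff_colLen, ← YoungDiagram.addBox_iff_colLen]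
      exact hs ⟨s, hsn⟩)
  have hn : F n n = rowCols m := by
    rw [hd n, show τ n = _ from hτ (Fin.last n), hm, colLen_rowShape]
  obtain ⟨D, hX, hP⟩ := OpenMatching.exists_of_incidence_count (n := n) (X := X)
    (P := fun v => F v n ≠ F (v + 1) n) (by
      intro v hv
      have h := hF.incidence hv
      by_cases he : F v n = F (v + 1) n
      · rw [if_pos he] at h
        rwa [if_neg (not_not.mpr he)]
      · rw [if_neg he] at h
        rwa [if_pos he])
  refine ⟨D, F, ⟨hF.zero, hF.antitone, hF.left, hF.right, fun i s h1 h2 => ?_, hF.diag⟩,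
    fun i hi => ?_, fun s => by rw [hd, hτ]⟩
  · rw [propext (hX i s h1 h2)]
    exact hF.rule i s h1 h2
  · rw [hF.row hn hi, countBelow_congr fun v hv => hP v (hv.trans_le hi)]

/-- The diagonal determines the crosses and the rows `F i n`; an open arc starts at `v` exactly when
the row grows from `v` to `v + 1`. -/
theorem matching_unique (h : Corresponds t D) (h' : Corresponds t E) : D = E := by
  obtain ⟨F, hF, ht, hd⟩ := h
  obtain ⟨F', hF', ht', hd'⟩ := h'
  have hdiag : ∀ s ≤ n, F s s = F' s s := fun s hs =>
    (hd ⟨s, Nat.lt_succ_of_le hs⟩).symm.trans (hd' ⟨s, Nat.lt_succ_of_le hs⟩)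
  have hc : ∀ i ≤ n, countBelow D.IsOpenAt i = countBelow E.IsOpenAt i := by
    intro i hi
    apply rowCols_injective
    rw [← ht i hi, ← ht' i hi]
    obtain ⟨d, rfl⟩ := Nat.exists_eq_add_of_le hi
    exact (hF.eq_of_diagonal hF' hdiag d).1 i le_rfl
  refine OpenMatching.ext_of_cross
    (fun i s h1 h2 => hF.cross_iff_of_diagonal hF' hdiag h1 h2) fun v hv => ?_
  have h1 := hc v hv.le
  have h2 := hc (v + 1) hv
  by_cases hD : D.IsOpenAt v <;> by_cases hE : E.IsOpenAt v
  · exact iff_of_true hD hE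
  · rw [countBelow_succ_of_pos hD, countBelow_succ_of_neg hE] at h2
    omega
  · rw [countBelow_succ_of_neg hD, countBelow_succ_of_pos hE] at h2
    omega
  · exact iff_of_false hD hE

theorem tableau_unique (h : Corresponds t D) (h' : Corresponds u D) : t = u := by
  obtain ⟨F, hF, ht, hd⟩ := h
  obtain ⟨F', hF', ht', hd'⟩ := h'
  funext s
  apply YoungDiagram.colLen_injective
  rw [hd, hd']
  exact hF.eq_of_crosses hF' (fun i hi => (ht i hi).trans (ht' i hi).symm) le_rfl
    (Nat.le_of_lt_succ s.2)

theorem exists_tableau (D : OpenMatching n) : ∃ t, Corresponds t D := by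
  obtain ⟨F, hF, ht⟩ := exists_isGrowth_of_crosses (n := n) (X := D.Cross) (P := D.IsOpenAt)
    (fun i s h => h.lt) fun v hv => D.incidence_count hv
  -- `IsGrowth` does not bound the number of nonempty columns; finiteness comes from the diagonal,
  -- where each step adds at most one box.
  have hfin : ∀ s ≤ n, ∃ N, ∀ j, N ≤ j → F s s j = 0 := by
    intro s hs
    induction s with
    | zero => exact ⟨0, fun j _ => by rw [hF.zero 0 hs]; rfl⟩
    | succ s ih =>
      obtain ⟨N, hN⟩ := ih (by omega)
      rcases hF.diag s hs with ⟨-, c, hc⟩ | ⟨-, c, hc⟩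
      · refine ⟨max N (c + 1), fun j hj => ?_⟩
        rw [hc, Pi.add_apply, hN j (by omega), Pi.single_eq_of_ne (by omega), add_zero]
      · refine ⟨N, fun j hj => ?_⟩
        have := hN j hj
        rw [hc, Pi.add_apply] at this
        omega
  have hex : ∀ s : Fin (n + 1), ∃ μ : YoungDiagram, μ.colLen = F s s := by
    intro s
    have hs := Nat.le_of_lt_succ s.2
    obtain ⟨N, hN⟩ := hfin s hs
    exact YoungDiagram.exists_colLen_eq (hF.antitone s s le_rfl hs) (hN N le_rfl)
  choose t htF using hex
  exact ⟨t, F, hF, fun i _ => ht i, htF⟩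

theorem first_eq_bot (h : Corresponds t D) : t 0 = ⊥ := by
  obtain ⟨F, hF, -, hd⟩ := h
  apply YoungDiagram.colLen_injective
  rw [hd, YoungDiagram.colLen_bot]
  exact hF.zero 0 (Nat.zero_le n)

theorem addBox_or_addBox (h : Corresponds t D) (s : Fin n) :
    (t s.castSucc).AddBox (t s.succ) ∨ (t s.succ).AddBox (t s.castSucc) := by
  obtain ⟨F, hF, -, hd⟩ := h
  rw [YoungDiagram.addBox_iff_colLen, YoungDiagram.addBox_iff_colLen, hd, hd]
  exact (hF.diag s s.2).imp (fun h => h.2) fun h => h.2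

theorem last_eq_rowShape (h : Corresponds t D) :
    t (Fin.last n) = rowShape D.openArcs.card := by
  obtain ⟨F, hF, ht, hd⟩ := h
  apply YoungDiagram.colLen_injective
  rw [hd, colLen_rowShape, ← D.countBelow_isOpenAt]
  exact ht n le_rfl

theorem height_le_iff (h : Corresponds t D) (k : ℕ) :
    (∀ s, (t s).colLen 0 ≤ k) ↔ ¬ D.HasNesting (k + 1) ∧ ¬ D.HasFutureNesting (k + 1) := by
  obtain ⟨F, hF, ht, hd⟩ := h
  rw [← not_or, ← D.exists_nestChain_iff]
  push Not
  constructor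
  · intro hk s hs hc
    rw [← hF.le_first_col_iff (fun _ _ h => h.lt_right) ht le_rfl hs] at hc
    have := hk ⟨s, Nat.lt_succ_of_le hs⟩
    rw [hd] at this
    dsimp only at this
    omega
  · intro hk s
    have hs := Nat.le_of_lt_succ s.2
    have := hk s hs
    rw [← hF.le_first_col_iff (fun _ _ h => h.lt_right) ht le_rfl hs] at this
    rw [hd]
    omega

end Corresponds

theorem nonempty_tableaux_equiv_matchings (n k m : ℕ) :
    Nonempty (oscillatingTableaux n k m ≃ nonnestingOpenMatchings n k m) := by
  have hex : ∀ t : oscillatingTableaux n k m, ∃ D : nonnestingOpenMatchings n k m,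
      Corresponds t.1 D.1 := by
    rintro ⟨t, h0, hs, hk, hm⟩
    obtain ⟨D, hD⟩ := Corresponds.exists_matching h0 hs hm
    refine ⟨⟨D, ?_, (hD.height_le_iff k).mp hk⟩, hD⟩
    apply rowCols_injective
    rw [← colLen_rowShape, ← colLen_rowShape, ← hD.last_eq_rowShape, hm]
  choose f hf using hex
  refine ⟨Equiv.ofBijective f ⟨fun t u h => Subtype.ext ?_, ?_⟩⟩
  · exact (hf t).tableau_unique (h ▸ hf u)
  · rintro ⟨D, hm, hk⟩
    obtain ⟨t, ht⟩ := Corresponds.exists_tableau D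
    refine ⟨⟨t, ht.first_eq_bot, ht.addBox_or_addBox, (ht.height_le_iff k).mpr hk, ?_⟩, ?_⟩
    · rw [ht.last_eq_rowShape, hm]
    · exact Subtype.ext ((hf _).matching_unique ht)

theorem theorem3 (n k m : ℕ) :
    Nonempty (oscillatingTableaux n k m ≃ nonnestingOpenMatchings n k m) ∧
    (1 ≤ k ∨ m = 0 →
      Nonempty (oscillatingTableaux n k m ≃ oscillatingWalks n k (rowPoint k m)) ∧
      Nonempty (oscillatingWalks n k (rowPoint k m) ≃ nonnestingOpenMatchings n k m)) := by
  obtain ⟨e⟩ := nonempty_tableaux_equiv_matchings n k m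
  refine ⟨⟨e⟩, fun hkm => ?_⟩
  obtain ⟨e'⟩ := nonempty_tableaux_equiv_walks n hkm
  exact ⟨⟨e'⟩, ⟨e'.symm.trans e⟩⟩
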